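/- **Setting.** Let $\mathbb M$ be a saturated (monster) model of a complete, possibly many-sorted, first-order theory in a language $L$, let $A\subset\mathbb M$ be a small set of parameters ($|A|<|\mathbb M|$), and let $p\in S(A)$ be a complete type in finitely many variables, with set of realizations $p(\mathbb M)$. A relation between elements of $p(\mathbb M)$ and/or of $A$-definable sets is *relatively ($A$-)definable* if it is the trace of an ($A$-)definable set of tuples on the corresponding product. Given a linear order $(X,<)$, a set $C\subseteq X$ is *convex* if $a,b\in C$ and $a<c<b$ imply $c\in C$; the *convex components* of a set are its maximal convex subsets; an equivalence relation is *convex* if all its classes are. The pair $(p,<_p)$ is a *weakly o-minimal pair over $A$* if $<_p$ is a relatively $A$-definable linear order on $p(\mathbb M)$ and every relatively definable (with arbitrary parameters from $\mathbb M$) subset of $p(\mathbb M)$ has finitely many convex components with respect to $<_p$. Let $\mathcal E_p$ be the set of all relatively $A$-definable equivalence relations on $p(\mathbb M)$. For a linear order $(X,<)$ and an equivalence relation $E$ on $X$ put $$x<_E y\iff (E(x,y)\wedge y<x)\vee(\neg E(x,y)\wedge x<y),$$ and for a sequence $\vec E=(E_0,\dots,E_n)$ put $<_{\vec E}:=(\dots((<_{E_0})_{E_1})\dots)_{E_n}$.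 A function $f:X\to Y$ is $(<_X,<_Y)$-*increasing* if $x<_Xx'$ implies $f(x)<_Yf(x')$ or $f(x)=f(x')$. Increasing and strictly increasing sequences of equivalence relations are meant with respect to inclusion. $\operatorname{Ker} f$ is the relation $f(x)=f(x')$. **Theorem (Weak monotonicity).** Let $(p,<_p)$ be a weakly o-minimal pair over $A$, let $(D,<)$ be an $A$-definable linear order (of finite tuples), and let $f:p(\mathbb M)\to D$ be a relatively $A$-definable non-constant function. (i) There is a unique strictly increasing sequence $\vec E=(E_0,\dots,E_n)\in\mathcal E_p^{\,n+1}$ ($n\ge 0$ not fixed in advance) such that $E_0=\operatorname{Ker} f$ and $f$ is $((<_p)_{\vec E},<)$-increasing. Moreover, all members of this sequence are convex with respect to $<_p$. (ii) There is a non-empty increasing sequence $\vec F=(F_0,\dots,F_n)$ of $A$-definable convex equivalence relations on $(D,<)$ such that $f$ is $(<_p,<_{\vec F})$-increasing. -/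

import Mathlib

universe u v w m

/-! ### Many-sorted first-order logic -/

/-- A (possibly many-sorted) first-order language. One-sorted languages are those whose type of
sorts has one element. -/
structure SortedLanguage where
  /-- the sorts -/
  Sorts : Type u
  /-- function symbols with given argument sorts and value sort -/
  Functions : (n : ℕ) → (Fin n → Sorts) → Sorts → Type v
  /-- relation symbols with given argument sorts -/
  Relations : (n : ℕ) → (Fin n → Sorts) → Type w

namespace SortedLanguage

/-- An interpretation of the symbols of `L` in the family of domains `M`. -/
class Structure (L : SortedLanguage.{u, v, w}) (M : L.Sorts → Type m) where
  /-- interpretation of function symbols -/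
  funMap : ∀ {n : ℕ} {a : Fin n → L.Sorts} {s : L.Sorts},
    L.Functions n a s → (∀ i, M (a i)) → M s
  /-- interpretation of relation symbols -/
  relMap : ∀ {n : ℕ} {a : Fin n → L.Sorts}, L.Relations n a → (∀ i, M (a i)) → Prop

/-- Terms of `L` whose variables are indexed by `α`; the variable `i` has sort `σ i`. -/
inductive Term (L : SortedLanguage.{u, v, w}) {α : Type*} (σ : α → L.Sorts) : L.Sorts → Type _
  | var (i : α) : Term L σ (σ i)
  | func {n : ℕ} {a : Fin n → L.Sorts} {s : L.Sorts} (f : L.Functions n a s)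
      (ts : ∀ i, Term L σ (a i)) : Term L σ s

/-- Adding one variable of sort `s` to a sorted family of variables. -/
def extendSorts {S α : Type*} (s : S) (σ : α → S) : Option α → S
  | none => s
  | some i => σ i

/-- First-order formulas of `L` whose free variables are among those indexed by `α`, where the
variable `i` has sort `σ i`. -/
inductive Formula (L : SortedLanguage.{u, v, w}) : {α : Type m} → (α → L.Sorts) → Type _
  | falsum {α : Type m} {σ : α → L.Sorts} : Formula L σ
  | equal {α : Type m} {σ : α → L.Sorts} {s : L.Sorts} (t₁ t₂ : Term L σ s) : Formula L σ
  | rel {α : Type m} {σ : α → L.Sorts} {n : ℕ} {a : Fin n → L.Sorts} (R : L.Relations n a)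
      (ts : ∀ i, Term L σ (a i)) : Formula L σ
  | imp {α : Type m} {σ : α → L.Sorts} (φ ψ : Formula L σ) : Formula L σ
  | all {α : Type m} {σ : α → L.Sorts} (s : L.Sorts) (φ : Formula L (extendSorts s σ)) :
      Formula L σ

/-- Negation. -/
def Formula.not {L : SortedLanguage.{u, v, w}} {α : Type*} {σ : α → L.Sorts}
    (φ : Formula L σ) : Formula L σ :=
  φ.imp Formula.falsum

section Semantics

variable {L : SortedLanguage.{u, v, w}} (M : L.Sorts → Type m)

/-- Tuples of elements of `M` with sorts prescribed by `σ`. -/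
abbrev Tuple {α : Type*} (σ : α → L.Sorts) : Type _ := ∀ i, M (σ i)

variable {M}

/-- Extending an assignment by a value for the new variable. -/
def extendTuple {α : Type*} {σ : α → L.Sorts} {s : L.Sorts} (a : M s) (v : Tuple M σ) :
    Tuple M (extendSorts s σ)
  | none => a
  | some i => v i

/-- Concatenation `(v, w)` of two tuples. -/
def Tuple.append {α β : Type*} {σ : α → L.Sorts} {τ : β → L.Sorts}
    (v : Tuple M σ) (w : Tuple M τ) : Tuple M (Sum.elim σ τ)
  | Sum.inl i => v i
  | Sum.inr j => w j

variable [L.Structure M]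

/-- The value of a term under an assignment. -/
def Term.eval {α : Type*} {σ : α → L.Sorts} (v : Tuple M σ) : {s : L.Sorts} → Term L σ s → M s
  | _, .var i => v i
  | _, .func f ts => Structure.funMap f (fun i => (ts i).eval v)

/-- Satisfaction of a formula under an assignment. -/
def Formula.Realize : {α : Type*} → {σ : α → L.Sorts} → Formula L σ → Tuple M σ → Prop
  | _, _, .falsum, _ => False
  | _, _, .equal t₁ t₂, v => t₁.eval v = t₂.eval v
  | _, _, .rel R ts, v => Structure.relMap R (fun i => (ts i).eval v)
  | _, _, .imp φ ψ, v => φ.Realize v → ψ.Realize v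
  | _, _, .all s φ, v => ∀ a : M s, φ.Realize (extendTuple a v)

/-! ### Formulas with parameters, definable sets, types, saturation -/

/-- The names of the elements of a parameter set `A`, with their sorts. -/
abbrev paramSort (A : ∀ s, Set (M s)) : (Σ s, A s) → L.Sorts := Sigma.fst

/-- `L_A`-formulas in the variables `σ`: variables indexed by elements of `A` stand for
the parameters. -/
abbrev FormulaOver (A : ∀ s, Set (M s)) {α : Type} (σ : α → L.Sorts) : Type _ :=
  Formula L (Sum.elim (paramSort A) σ)

/-- Satisfaction of an `L_A`-formula by a tuple, each parameter being interpreted as itself. -/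
def FormulaOver.Holds {A : ∀ s, Set (M s)} {α : Type} {σ : α → L.Sorts}
    (φ : FormulaOver A σ) (x : Tuple M σ) : Prop :=
  Formula.Realize φ (Tuple.append (M := M) (σ := paramSort A) (fun c => (c.2 : M c.1)) x)

variable (L) in
/-- `X` is an `A`-definable set of tuples. -/
def DefinableOver (A : ∀ s, Set (M s)) {α : Type} {σ : α → L.Sorts} (X : Set (Tuple M σ)) :
    Prop :=
  ∃ φ : FormulaOver A σ, ∀ x, x ∈ X ↔ φ.Holds x

/-- A set of `L_A`-formulas that is finitely satisfiable in `M`. -/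
def FinitelySatisfiable {A : ∀ s, Set (M s)} {α : Type} {σ : α → L.Sorts}
    (Γ : Set (FormulaOver A σ)) : Prop :=
  ∀ Δ ⊆ Γ, Δ.Finite → ∃ x : Tuple M σ, ∀ φ ∈ Δ, φ.Holds x

/-- A parameter set is small if its cardinality is less than that of `M`. -/
def IsSmall (A : ∀ s, Set (M s)) : Prop :=
  Cardinal.mk (Σ s, A s) < Cardinal.mk (Σ s, M s)

variable (L M) in
/-- `M` is saturated: every finitely satisfiable set of formulas in finitely many variables over a
small parameter set is realized in `M`. -/
def IsSaturated : Prop :=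
  ∀ A : ∀ s, Set (M s), IsSmall A → ∀ (n : ℕ) (σ : Fin n → L.Sorts) (Γ : Set (FormulaOver A σ)),
    FinitelySatisfiable Γ → ∃ x : Tuple M σ, ∀ φ ∈ Γ, φ.Holds x

/-- The complete types over `A` (in `M`) in the variables `σ`. -/
structure TypeOver (A : ∀ s, Set (M s)) {n : ℕ} (σ : Fin n → L.Sorts) where
  /-- the formulas that belong to the type -/
  formulas : Set (FormulaOver A σ)
  finitelySatisfiable : FinitelySatisfiable formulas
  complete : ∀ φ : FormulaOver A σ, φ ∈ formulas ∨ Formula.not φ ∈ formulas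

/-- The set `p(M)` of realizations of `p` in `M`. -/
def TypeOver.locus {A : ∀ s, Set (M s)} {n : ℕ} {σ : Fin n → L.Sorts} (p : TypeOver A σ) :
    Set (Tuple M σ) :=
  {x | ∀ φ ∈ p.formulas, φ.Holds x}

/-- The relation `R` between elements of `P` and elements of `Q` is relatively `A`-definable within
`P × Q`, i.e. it is the trace on `P × Q` of an `A`-definable set. If `P` and `Q` are themselves
`A`-definable, this says that `R` is `A`-definable. -/
def RelDefinable (A : ∀ s, Set (M s)) {n k : ℕ} {σ : Fin n → L.Sorts} {τ : Fin k → L.Sorts}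
    {P : Set (Tuple M σ)} {Q : Set (Tuple M τ)} (R : P → Q → Prop) : Prop :=
  ∃ Z : Set (Tuple M (Sum.elim σ τ)), DefinableOver L A Z ∧
    ∀ (x : P) (y : Q), R x y ↔ Tuple.append x.1 y.1 ∈ Z

end Semantics

end SortedLanguage

/-! ### Convex sets and equivalence relations in linear orders -/

section Orders

variable {X Y : Type*}

/-- `C` is convex with respect to the strict order `r`. -/
def IsConvexFor (r : X → X → Prop) (C : Set X) : Prop :=
  ∀ a ∈ C, ∀ b ∈ C, ∀ c, r a c → r c b → c ∈ C

/-- The convex components of `D`: its maximal convex subsets. -/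
def convexComponents (r : X → X → Prop) (D : Set X) : Set (Set X) :=
  {C | Maximal (fun C' => C' ⊆ D ∧ IsConvexFor r C') C}

/-- `E` has convex classes with respect to the strict order `r`. -/
def HasConvexClasses (r : X → X → Prop) (E : X → X → Prop) : Prop :=
  ∀ x, IsConvexFor r {y | E x y}

/-- The order `<_E`, obtained from `<` by reversing it inside each class of `E`. -/
def reverseIn (r : X → X → Prop) (E : X → X → Prop) : X → X → Prop :=
  fun x y => (E x y ∧ r y x) ∨ (¬ E x y ∧ r x y)

/-- The iterated order `(…(<_{E₀})_{E₁}…)_{Eₙ}` for a sequence `(E₀, …, Eₙ)`. -/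
def reverseInSeq (r : X → X → Prop) (Es : List (X → X → Prop)) : X → X → Prop :=
  Es.foldl reverseIn r

/-- `f` is (weakly) increasing from the strict order `r` to the strict order `s`. -/
def IsIncreasing (r : X → X → Prop) (s : Y → Y → Prop) (f : X → Y) : Prop :=
  ∀ x x', r x x' → s (f x) (f x') ∨ f x = f x'

/-- The kernel of `f`. -/
def kernelRel (f : X → Y) : X → X → Prop := fun x x' => f x = f x'

end Orders

namespace SortedLanguage

variable {L : SortedLanguage.{u, v, w}} {M : L.Sorts → Type m} [L.Structure M]

/-- `(p, <)` is a weakly o-minimal pair over `A`: `<` is a relatively `A`-definable linear order on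
`p(M)`, and every relatively definable (with arbitrary parameters) subset of `p(M)` has finitely
many convex components. -/
structure IsWeaklyOMinimalPair {A : ∀ s, Set (M s)} {n : ℕ} {σ : Fin n → L.Sorts}
    (p : TypeOver A σ) (lt : p.locus → p.locus → Prop) : Prop where
  linear : IsStrictTotalOrder p.locus lt
  definable : RelDefinable A lt
  finite_components : ∀ X : Set (Tuple M σ), DefinableOver L (fun _ => Set.univ) X →
    (convexComponents lt {x : p.locus | x.1 ∈ X}).Finite

/-- The set `𝓔_p` of relatively `A`-definable equivalence relations on `p(M)`. -/
def relDefinableEquivs {A : ∀ s, Set (M s)} {n : ℕ} {σ : Fin n → L.Sorts}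
    (p : TypeOver A σ) : Set (p.locus → p.locus → Prop) :=
  {E | Equivalence E ∧ RelDefinable A E}

end SortedLanguage

/-! Put q(x, y) for f(x) < f(y), a relatively definable strict weak order whose incomparability
relation is Ker f. Two features of p(𝕄) drive the proof: realizations of p are alike over A, by
back-and-forth in the saturated model, and a set definable with parameters cannot alternate
infinitely often with its complement along a monotone sequence (`JoinsSequences`).
`HomogeneousOrder` axiomatizes both. They force relatively definable equivalence relations to be
convex (`Def.convex`) and pairwise comparable (`Def.comparable`).

Existence in (i): inside the classes of a relation G strictly coarser than Ker f, q is eventually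
increasing from every point or eventually decreasing from every point. In the increasing case, the
points of the class that are not q-above x determine a cut. The crux, `Returns.of_between`, makes
these cuts monotone in x, so having the same cut is an equivalence relation E strictly below G.
Between E and G the function increases; inside E it eventually decreases, unless E = Ker f. The
descent continues with the opposite sign. It stops, since otherwise the sign would alternate forever
along a sequence descending towards x (`no_alternating_descent`). The relations met on the way form
the required sequence.

Uniqueness: if the largest members of two such sequences differed, some pair would be reversed once
by one sequence and never by the other (`not_last_lt`). Equal last members can be cancelled.

For (ii), the classes of each member are convex also for the order of values
(`Represents.q_convex`), so the convex hulls of their images are classes of an equivalence relation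
on D. It is A-definable once p(𝕄) is replaced by a suitable A-definable superset, found by
compactness. The pullbacks are the original relations, so x, y and f(x), f(y) are reversed equally
often. -/

/-! ### Iterated reversals of an order -/

section Reversal

variable {X Y : Type*}

open Classical in
/-- The number of members of a list of relations that hold between two given elements. -/
noncomputable def relCount (Es : List (X → X → Prop)) (x y : X) : ℕ :=
  Es.countP (fun E => decide (E x y))

theorem relCount_cons (E : X → X → Prop) (Es : List (X → X → Prop)) (x y : X) [Decidable (E x y)] :
    relCount (E :: Es) x y = relCount Es x y + if E x y then 1 else 0 := by
  simp [relCount, List.countP_cons]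

theorem relCount_eq_zero {Es : List (X → X → Prop)} {x y : X} (h : ∀ E ∈ Es, ¬ E x y) :
    relCount Es x y = 0 := by
  simpa [relCount, List.countP_eq_zero] using h

theorem relCount_congr {Es : List (X → X → Prop)} {x y x' y' : X}
    (h : ∀ E ∈ Es, (E x y ↔ E x' y')) : relCount Es x y = relCount Es x' y' := by
  unfold relCount
  apply List.countP_congr
  intro E hE
  simpa using h E hE

/-- Each member of the list that relates x and y swaps the pair once, so only the parity of their
number matters. -/
theorem reverseInSeq_iff (r : X → X → Prop) (Es : List (X → X → Prop))
    (hs : ∀ E ∈ Es, ∀ x y, E x y → E y x) (x y : X) :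
    reverseInSeq r Es x y ↔ if Even (relCount Es x y) then r x y else r y x := by
  classical
  induction Es generalizing r with
  | nil => simp [reverseInSeq, relCount]
  | cons E Es ih =>
    have hE : E y x ↔ E x y := ⟨hs E (by simp) _ _, hs E (by simp) _ _⟩
    have h := ih (reverseIn r E) (fun F hF => hs F (by simp [hF]))
    have h' : reverseInSeq r (E :: Es) = reverseInSeq (reverseIn r E) Es := rfl
    rw [h', h, relCount_cons]
    by_cases hxy : E x y <;> by_cases hev : Even (relCount Es x y) <;>
      simp [reverseIn, hE, hxy, hev, Nat.even_add_one]

theorem reverseInSeq_concat_iff {r : X → X → Prop} {l : List (X → X → Prop)} {E : X → X → Prop}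
    {x y : X} : reverseInSeq r (l ++ [E]) x y ↔
      (E x y ∧ reverseInSeq r l y x) ∨ (¬ E x y ∧ reverseInSeq r l x y) := by
  simp [reverseInSeq, reverseIn]

end Reversal

/-! ### Homogeneous linear orders with a weakly o-minimal family of subsets -/

/-- Every sequence in `Y` has two terms that are joined by an interval inside `Y`; this holds when
`Y` has finitely many convex components. -/
def JoinsSequences {X : Type*} [LinearOrder X] (Y : Set X) : Prop :=
  ∀ a : ℕ → X, (∀ i, a i ∈ Y) →
    ∃ i j, i < j ∧ ∀ z, (a i < z ∧ z < a j) ∨ (a j < z ∧ z < a i) → z ∈ Y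

/-- Pigeonhole: two terms share a component. The component of y is written out as `comp y`, the
points of Y joined to y inside Y. -/
theorem JoinsSequences.of_finite_components {X : Type*} [LinearOrder X] {Y : Set X}
    (h : (convexComponents (· < ·) Y).Finite) : JoinsSequences Y := by
  intro a ha
  let comp : X → Set X := fun y => {z | z ∈ Y ∧ ∀ t, (y < t ∧ t < z) ∨ (z < t ∧ t < y) → t ∈ Y}
  have hself : ∀ y ∈ Y, y ∈ comp y := fun y hy => ⟨hy, fun t ht => by
    rcases ht with ht | ht <;> exact absurd (ht.1.trans ht.2) (lt_irrefl _)⟩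
  have hcomp : ∀ y ∈ Y, comp y ∈ convexComponents (· < ·) Y := by
    intro y hy
    refine ⟨⟨fun z hz => hz.1, ?_⟩, ?_⟩
    · intro u hu v hv c huc hcv
      have hcY : c ∈ Y := by
        rcases lt_trichotomy c y with h1 | h1 | h1
        · exact hu.2 c (Or.inr ⟨huc, h1⟩)
        · exact h1 ▸ hy
        · exact hv.2 c (Or.inl ⟨h1, hcv⟩)
      refine ⟨hcY, fun t ht => ?_⟩
      rcases ht with ⟨h1, h2⟩ | ⟨h1, h2⟩
      · exact hv.2 t (Or.inl ⟨h1, h2.trans hcv⟩)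
      · exact hu.2 t (Or.inr ⟨huc.trans h1, h2⟩)
    · intro C hC hle z hz
      have hyC : y ∈ C := hle (hself y hy)
      refine ⟨hC.1 hz, fun t ht => hC.1 ?_⟩
      rcases ht with ⟨h1, h2⟩ | ⟨h1, h2⟩
      · exact hC.2 y hyC z hz t h1 h2
      · exact hC.2 z hz y hyC t h1 h2
  have := h.to_subtype
  obtain ⟨i, j, hij, he⟩ := Finite.exists_ne_map_eq_of_infinite
    (fun i : ℕ => (⟨comp (a i), hcomp _ (ha i)⟩ : convexComponents (· < ·) Y))
  have he' : comp (a i) = comp (a j) := congrArg Subtype.val he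
  rcases lt_or_gt_of_ne hij with hlt | hlt
  · have : a j ∈ comp (a i) := he' ▸ hself _ (ha j)
    exact ⟨i, j, hlt, this.2⟩
  · have : a i ∈ comp (a j) := he' ▸ hself _ (ha i)
    exact ⟨j, i, hlt, this.2⟩

/-- A nonempty set with finitely many convex components is convex from some point on. -/
theorem JoinsSequences.exists_final_convex {X : Type*} [LinearOrder X] {Y : Set X}
    (h : JoinsSequences Y) (hne : Y.Nonempty) :
    ∃ c ∈ Y, ∀ y ∈ Y, ∀ z, c < z → z < y → z ∈ Y := by
  by_contra! hcon
  -- Iterating this produces an increasing sequence in Y with a gap after every term, so no two of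
  -- its terms are joined.
  have hstep : ∀ c : Y, ∃ y : Y, ∃ z, c.1 < z ∧ z < y.1 ∧ z ∉ Y := by
    rintro ⟨c, hc⟩
    obtain ⟨y, hy, z, h1, h2, h3⟩ := hcon c hc
    exact ⟨⟨y, hy⟩, z, h1, h2, h3⟩
  choose nxt gap h1 h2 h3 using hstep
  obtain ⟨y0, hy0⟩ := hne
  let a : ℕ → Y := fun i => nxt^[i] ⟨y0, hy0⟩
  have ha : ∀ i, a (i + 1) = nxt (a i) := fun i => Function.iterate_succ_apply' _ _ _
  have hmono : StrictMono (fun i => (a i).1) := strictMono_nat_of_lt_succ fun i => by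
    rw [ha]; exact (h1 _).trans (h2 _)
  obtain ⟨i, j, hij, hz⟩ := h (fun i => (a i).1) (fun i => (a i).2)
  refine h3 (a i) (hz _ (Or.inl ⟨h1 _, lt_of_lt_of_le (h2 (a i)) ?_⟩))
  rw [← ha]
  exact hmono.monotone hij

/-- A linear order with a back-and-forth system of finite partial maps that is transitive on
points, a family of subsets `paramDef` (to be thought of as definable with parameters) in which
sequences are joined, and a family `Def` of invariant binary relations. -/
structure HomogeneousOrder (X : Type*) [LinearOrder X] where
  /-- the finite partial maps, as lists of pairs -/
  PartialMap : List (X × X) → Prop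
  mono : ∀ {l l'}, PartialMap l → l' ⊆ l → PartialMap l'
  extend : ∀ {l}, PartialMap l → ∀ z, ∃ z', PartialMap ((z, z') :: l)
  swap : ∀ {l}, PartialMap l → PartialMap (l.map Prod.swap)
  single : ∀ x y, PartialMap [(x, y)]
  /-- the sets definable with parameters -/
  paramDef : Set (Set X)
  paramDef_compl : ∀ {Y}, Y ∈ paramDef → Yᶜ ∈ paramDef
  paramDef_inter : ∀ {Y Y'}, Y ∈ paramDef → Y' ∈ paramDef → Y ∩ Y' ∈ paramDef
  joins : ∀ {Y}, Y ∈ paramDef → JoinsSequences Y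
  /-- the definable binary relations -/
  Def : (X → X → Prop) → Prop
  def_inv : ∀ {R}, Def R → ∀ {x x' y y'}, PartialMap [(x, x'), (y, y')] → (R x y ↔ R x' y')
  def_fibre : ∀ {R}, Def R → ∀ x, {y | R x y} ∈ paramDef
  def_flip : ∀ {R}, Def R → Def (fun x y => R y x)
  -- This replaces closure under quantifiers. For types it holds by compactness
  -- (`relDefinable_of_fibre`).
  def_of : ∀ {R : X → X → Prop},
    (∀ {x x' y y'}, PartialMap [(x, x'), (y, y')] → (R x y ↔ R x' y')) →
    (∀ x, {y | R x y} ∈ paramDef) → Def R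
  def_lt : Def (· < ·)

namespace HomogeneousOrder

/-! ### Strict weak orders, such as comparison of the values of a function. -/

section WeakOrders

variable {X : Type*}

/-- `q` is a strict weak order. -/
structure WeakOrder (q : X → X → Prop) : Prop where
  asymm : ∀ {x y}, q x y → ¬ q y x
  negTrans : ∀ {x y z}, ¬ q x y → ¬ q y z → ¬ q x z

theorem WeakOrder.flip {q : X → X → Prop} (hq : WeakOrder q) : WeakOrder (fun x y => q y x) :=
  ⟨fun h => hq.asymm h, fun h h' => hq.negTrans h' h⟩

/-- Incomparability for `q`. -/
def Incomp (q : X → X → Prop) : X → X → Prop := fun x y => ¬ q x y ∧ ¬ q y x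

theorem WeakOrder.irrefl {q : X → X → Prop} (hq : WeakOrder q) (x : X) : ¬ q x x :=
  fun h => hq.asymm h h

theorem WeakOrder.equivalence {q : X → X → Prop} (hq : WeakOrder q) : Equivalence (Incomp q) :=
  ⟨fun x => ⟨hq.irrefl x, hq.irrefl x⟩, fun h => ⟨h.2, h.1⟩,
    fun h h' => ⟨hq.negTrans h.1 h'.1, hq.negTrans h'.2 h.2⟩⟩

/-- `q` or its converse. -/
def signed (q : X → X → Prop) : Bool → X → X → Prop
  | true => q
  | false => fun x y => q y x

theorem signed_not (q : X → X → Prop) (b : Bool) : signed q (!b) = fun x y => signed q b y x := by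
  cases b <;> rfl

theorem signed_weakOrder {q : X → X → Prop} (hw : WeakOrder q) (b : Bool) :
    WeakOrder (signed q b) := by
  cases b
  · exact hw.flip
  · exact hw

theorem signed_incomp (q : X → X → Prop) (b : Bool) : Incomp (signed q b) = Incomp q := by
  cases b
  · funext x y; exact propext and_comm
  · rfl

end WeakOrders

variable {X : Type*} [LinearOrder X] (H : HomogeneousOrder X)

variable {H} in
theorem Def.iff {R : X → X → Prop} (hR : H.Def R) {l : List (X × X)} (hl : H.PartialMap l)
    {x x' y y' : X} (hx : (x, x') ∈ l) (hy : (y, y') ∈ l) : R x y ↔ R x' y' :=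
  H.def_inv hR (H.mono hl (by simp [hx, hy]))

/-- To be invariant it is enough to be preserved in one direction. -/
theorem inv_of_imp {R : X → X → Prop}
    (h : ∀ {x x' y y'}, H.PartialMap [(x, x'), (y, y')] → R x y → R x' y')
    {x x' y y' : X} (hs : H.PartialMap [(x, x'), (y, y')]) : R x y ↔ R x' y' :=
  ⟨h hs, h (by simpa using H.swap hs)⟩

variable {H} in
theorem Def.not {R : X → X → Prop} (hR : H.Def R) : H.Def (fun x y => ¬ R x y) :=
  H.def_of (fun hs => not_congr (H.def_inv hR hs)) (fun x => H.paramDef_compl (H.def_fibre hR x))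

variable {H} in
theorem Def.and {R R' : X → X → Prop} (hR : H.Def R) (hR' : H.Def R') :
    H.Def (fun x y => R x y ∧ R' x y) :=
  H.def_of (fun hs => and_congr (H.def_inv hR hs) (H.def_inv hR' hs))
    (fun x => H.paramDef_inter (H.def_fibre hR x) (H.def_fibre hR' x))

theorem paramDef_union {Y Y' : Set X} (h : Y ∈ H.paramDef) (h' : Y' ∈ H.paramDef) :
    Y ∪ Y' ∈ H.paramDef := by
  have := H.paramDef_compl (H.paramDef_inter (H.paramDef_compl h) (H.paramDef_compl h'))
  rwa [Set.compl_inter, compl_compl, compl_compl] at this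

theorem paramDef_Iic (c : X) : {y | y ≤ c} ∈ H.paramDef := by
  simpa only [not_lt] using H.def_fibre H.def_lt.not c

variable {H} in
/-- Definable equivalence relations are convex. -/
theorem Def.convex {E : X → X → Prop} (hE : H.Def E) (he : Equivalence E) {x y z : X}
    (hxz : x ≤ z) (hzy : z ≤ y) (hxy : E x y) : E x z := by
  rcases hxz.eq_or_lt with rfl | hxz
  · exact he.refl _
  rcases hzy.eq_or_lt with rfl | hzy
  · exact hxy
  by_contra hn
  -- The class of x is convex beyond `c`. Moving x to `c` carries the hole z to a hole of the same
  -- class beyond `c`.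
  obtain ⟨c, hc, hcc⟩ := (H.joins (H.def_fibre hE x)).exists_final_convex ⟨x, he.refl x⟩
  obtain ⟨y', h1⟩ := H.extend (H.single x c) y
  obtain ⟨z', h2⟩ := H.extend h1 z
  have e1 := (hE.iff h2 (x := x) (x' := c) (y := y) (y' := y') (by simp) (by simp)).1 hxy
  have e2 := mt (hE.iff h2 (x := x) (x' := c) (y := z) (y' := z') (by simp) (by simp)).2 hn
  have e3 := (H.def_lt.iff h2 (x := x) (x' := c) (y := z) (y' := z') (by simp) (by simp)).1 hxz
  have e4 := (H.def_lt.iff h2 (x := z) (x' := z') (y := y) (y' := y') (by simp) (by simp)).1 hzy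
  exact e2 (he.trans (he.symm hc) (hcc y' (he.trans hc e1) z' e3 e4))

variable {H} in
-- By symmetry a pair in G but not in E can be oriented upwards; homogeneity then moves its lower
-- point to x.
theorem Def.exists_right {E G : X → X → Prop} (hE : H.Def E) (hG : H.Def G) (he : Equivalence E)
    (hg : Equivalence G) (h : ¬ G ≤ E) (x : X) : ∃ y, x < y ∧ G x y ∧ ¬ E x y := by
  have : ∃ a b, a < b ∧ G a b ∧ ¬ E a b := by
    by_contra! hcon
    refine h fun a b hab => ?_
    rcases lt_trichotomy a b with h1 | rfl | h1
    · exact hcon a b h1 hab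
    · exact he.refl _
    · exact he.symm (hcon b a h1 (hg.symm hab))
  obtain ⟨a, b, hab, h1, h2⟩ := this
  obtain ⟨y, hs⟩ := H.extend (H.single a x) b
  exact ⟨y, (H.def_lt.iff hs (x := a) (x' := x) (y := b) (by simp) (by simp)).1 hab,
    (hG.iff hs (x := a) (x' := x) (y := b) (by simp) (by simp)).1 h1,
    mt (hE.iff hs (x := a) (x' := x) (y := b) (by simp) (by simp)).2 h2⟩

variable {H} in
/-- Definable equivalence relations are comparable. -/
theorem Def.comparable [Nonempty X] {E G : X → X → Prop} (hE : H.Def E) (hG : H.Def G)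
    (he : Equivalence E) (hg : Equivalence G) : E ≤ G ∨ G ≤ E := by
  by_contra! hcon
  obtain ⟨x⟩ := ‹Nonempty X›
  obtain ⟨y, h1, h2, h3⟩ := hE.exists_right hG he hg hcon.2 x
  obtain ⟨z, h4, h5, h6⟩ := hG.exists_right hE hg he hcon.1 x
  -- Both points lie above x, so the convex class containing the farther one contains the nearer one
  -- too.
  rcases le_total y z with h | h
  · exact h3 (hE.convex he h1.le h h5)
  · exact h6 (hG.convex hg h4.le h h2)

/-! ### Descending through the definable equivalence relations -/

variable {H} in
theorem Def.incomp {q : X → X → Prop} (hq : H.Def q) : H.Def (Incomp q) :=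
  hq.not.and (H.def_flip hq).not

/-- `q` is eventually increasing from `x` on, within the `G`-class of `x`. -/
def EventuallyAbove (G q : X → X → Prop) (x : X) : Prop :=
  ∃ w, G x w ∧ ∀ z, G x z → w ≤ z → q x z

/-- Some `G`-equivalent element above `y` is not `q`-above `x`. -/
def Returns (G q : X → X → Prop) (x y : X) : Prop :=
  G x y ∧ ∃ z, G x z ∧ y ≤ z ∧ ¬ q x z

/-- Comparison of the cuts at which the sets `Returns G q x` and `Returns G q y` end. -/
def ReturnsLE (G q : X → X → Prop) (x y : X) : Prop :=
  ∀ v, Returns G q x v → Returns G q y v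

section Returns

variable {H} {G q : X → X → Prop}

theorem EventuallyAbove.transfer (hG : H.Def G) (hq : H.Def q)
    {x : X} (h : EventuallyAbove G q x) (x' : X) : EventuallyAbove G q x' := by
  obtain ⟨w, h1, h2⟩ := h
  obtain ⟨w', hs⟩ := H.extend (H.single x x') w
  refine ⟨w', (hG.iff hs (x := x) (y := w) (by simp) (by simp)).1 h1, fun z' h3 h4 => ?_⟩
  obtain ⟨z, hs'⟩ := H.extend (H.swap hs) z'
  have hs'' := H.swap hs'
  simp only [List.map_cons, List.map_nil, Prod.swap] at hs''
  refine (hq.iff hs'' (x := x) (y := z) (by simp) (by simp)).1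
    (h2 z ((hG.iff hs'' (x := x) (y := z) (by simp) (by simp)).2 h3) ?_)
  by_contra hlt
  exact absurd ((H.def_lt.iff hs'' (x := z) (x' := z') (y := w) (y' := w') (by simp)
    (by simp)).1 (not_le.1 hlt)) (not_lt.2 h4)

theorem Returns.of_le {x y y' : X} (h : Returns G q x y) (hy' : G x y') (hle : y' ≤ y) :
    Returns G q x y' := by
  obtain ⟨_, z, h1, h2, h3⟩ := h
  exact ⟨hy', z, h1, hle.trans h2, h3⟩

theorem Returns.of_not {x y : X} (h : G x y) (h' : ¬ q x y) : Returns G q x y :=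
  ⟨h, y, h, le_rfl, h'⟩

theorem Returns.self (hg : Equivalence G) (hw : WeakOrder q) {x y : X} (h : G x y) (h' : y ≤ x) :
    Returns G q x y :=
  ⟨h, x, hg.refl x, h', hw.irrefl x⟩

theorem ReturnsLE.of_not (hg : Equivalence G) (hw : WeakOrder q) {x y : X} (h : G x y)
    (h' : ¬ q x y) : ReturnsLE G q y x := by
  rintro v ⟨h1, z, h2, h3, h4⟩
  exact ⟨hg.trans h h1, z, hg.trans h h2, h3, hw.negTrans h' h4⟩

theorem Returns.inv (hG : H.Def G) (hq : H.Def q) {x x' y y' : X}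
    (hs : H.PartialMap [(x, x'), (y, y')]) : Returns G q x y ↔ Returns G q x' y' := by
  refine H.inv_of_imp (fun {x x' y y'} hs h => ?_) hs
  obtain ⟨h0, z, h1, h2, h3⟩ := h
  obtain ⟨z', hs⟩ := H.extend hs z
  refine ⟨(hG.iff hs (x := x) (y := y) (by simp) (by simp)).1 h0, z',
    (hG.iff hs (x := x) (y := z) (by simp) (by simp)).1 h1, not_lt.1 (mt (H.def_lt.iff hs (x := z)
      (x' := z') (y := y) (y' := y') (by simp) (by simp)).2 (not_lt.2 h2)),
    mt (hq.iff hs (x := x) (y := z) (by simp) (by simp)).2 h3⟩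

theorem Returns.def (hG : H.Def G) (hg : Equivalence G) (hq : H.Def q) (hw : WeakOrder q) :
    H.Def (Returns G q) := by
  refine H.def_of (fun hs => Returns.inv hG hq hs) fun x => ?_
  have hB : {z | G x z ∧ ¬ q x z} ∈ H.paramDef := H.def_fibre (hG.and hq.not) x
  obtain ⟨c, hc, hcc⟩ := (H.joins hB).exists_final_convex ⟨x, hg.refl x, hw.irrefl x⟩
  -- The fibre is the downward closure of B within the class. As B is convex beyond `c`, closing
  -- downwards only adds points up to `c`; no quantifier is needed.
  have : {y | Returns G q x y} =
      {y | G x y} ∩ ({y | y ≤ c} ∪ {z | G x z ∧ ¬ q x z}) := by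
    ext y
    constructor
    · rintro ⟨h1, z, h2, h3, h4⟩
      refine ⟨h1, ?_⟩
      rcases le_or_gt y c with h | h
      · exact Or.inl h
      rcases h3.eq_or_lt with rfl | h3
      · exact Or.inr ⟨h1, h4⟩
      · exact Or.inr (hcc z ⟨h2, h4⟩ y h h3)
    · rintro ⟨h1, h2 | h2⟩
      · exact ⟨h1, c, hc.1, h2, hc.2⟩
      · exact Returns.of_not h1 h2.2
  rw [this]
  exact H.paramDef_inter (H.def_fibre hG x) (H.paramDef_union (H.paramDef_Iic c) hB)

theorem ReturnsLE.inv (hG : H.Def G) (hq : H.Def q) {x x' y y' : X}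
    (hs : H.PartialMap [(x, x'), (y, y')]) : ReturnsLE G q x y ↔ ReturnsLE G q x' y' := by
  refine H.inv_of_imp (fun {x x' y y'} hs h v' hv' => ?_) hs
  obtain ⟨v, hs'⟩ := H.extend (H.swap hs) v'
  have hs := H.swap hs'
  simp only [List.map_cons, List.map_nil, Prod.swap] at hs
  have h1 : H.PartialMap [(x, x'), (v, v')] := H.mono hs (by simp)
  have h2 : H.PartialMap [(y, y'), (v, v')] := H.mono hs (by simp)
  exact (Returns.inv hG hq h2).1 (h v ((Returns.inv hG hq h1).2 hv'))

/-- The cut of an element lying between two others cannot be nested below their cuts. -/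
theorem Returns.of_between (hG : H.Def G) (hg : Equivalence G) (hq : H.Def q) (hw : WeakOrder q)
    {x y z : X} (hxy : x < y) (hyz : y < z) (hGxz : G x z) (hle : ReturnsLE G q z x) :
    Returns G q y z := by
  by_contra hn
  -- Homogeneity copies the bad configuration below every t. Iterated from z, it yields a descending
  -- sequence of points that all return to z, separated by points that do not, against `joins`.
  have hstep : ∀ t, ∃ a b, a < b ∧ b < t ∧ G a t ∧ ReturnsLE G q t a ∧ ¬ Returns G q b t := by
    intro t
    obtain ⟨a, hs⟩ := H.extend (H.single z t) x
    obtain ⟨b, hs⟩ := H.extend hs y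
    refine ⟨a, b, (H.def_lt.iff hs (x := x) (x' := a) (y := y) (y' := b) (by simp) (by simp)).1 hxy,
      (H.def_lt.iff hs (x := y) (x' := b) (y := z) (y' := t) (by simp) (by simp)).1 hyz,
      (hG.iff hs (x := x) (y := z) (by simp) (by simp)).1 hGxz, ?_, ?_⟩
    · exact (ReturnsLE.inv hG hq (H.mono hs (by simp))).1 hle
    · exact mt (Returns.inv hG hq (H.mono hs (by simp))).2 hn
  choose lo gap h1 h2 h3 h4 h5 using hstep
  let a : ℕ → X := fun i => lo^[i] z
  have ha : ∀ i, a (i + 1) = lo (a i) := fun i => Function.iterate_succ_apply' _ _ _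
  have hanti : StrictAnti a := strictAnti_nat_of_succ_lt fun i => by
    rw [ha]; exact (h1 _).trans (h2 _)
  have hGa : ∀ i, G (a i) z := by
    intro i
    induction i with
    | zero => exact hg.refl z
    | succ i ih => rw [ha]; exact hg.trans (h3 _) ih
  have hle : ∀ i, ReturnsLE G q z (a i) := by
    intro i
    induction i with
    | zero => exact fun v hv => hv
    | succ i ih => rw [ha]; exact fun v hv => h4 _ v (ih v hv)
  have hmem : {u | Returns G q u z} ∈ H.paramDef :=
    H.def_fibre (H.def_flip (Returns.def hG hg hq hw)) z
  obtain ⟨i, j, hij, hbetween⟩ := H.joins hmem a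
    (fun i => hle i z (Returns.self hg hw (hg.refl z) le_rfl))
  have hlow : a j < gap (a i) := lt_of_le_of_lt (hanti.antitone hij) (by rw [ha]; exact h1 _)
  have hU : Returns G q (gap (a i)) z := hbetween _ (Or.inr ⟨hlow, h2 _⟩)
  have hGgap : G (gap (a i)) (a i) := by
    have e1 : G (lo (a i)) (a i) := h3 _
    exact hg.trans (hg.symm (hG.convex hg (h1 _).le (h2 _).le e1)) e1
  exact h5 _ (hU.of_le hGgap (hanti.antitone (Nat.zero_le i)))

/-- Either x or c itself serves: if x < c and the cut of c ended before that of x,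
`Returns.of_between`, applied to c and a later point that is not q-above x, would extend it. -/
theorem ReturnsLE.exists_above (hG : H.Def G) (hg : Equivalence G) (hq : H.Def q)
    (hw : WeakOrder q) {x c : X} (hc : G x c) (hqc : ¬ q x c) :
    ∃ z, c ≤ z ∧ G x z ∧ ¬ q x z ∧ ReturnsLE G q x z := by
  by_contra! hcon
  have hxc : x < c := by
    by_contra h
    exact hcon x (not_lt.1 h) (hg.refl x) (hw.irrefl x) fun v hv => hv
  obtain ⟨v, ⟨hv, w, h1, h2, h3⟩, hn⟩ :
      ∃ v, Returns G q x v ∧ ¬ Returns G q c v := by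
    simpa [ReturnsLE] using hcon c le_rfl hc hqc
  have hcv : G c v := hg.trans (hg.symm hc) hv
  have hcw : c < w := by
    by_contra h
    exact hn (Returns.self hg hw hcv (h2.trans (not_lt.1 h)))
  exact hn ((Returns.of_between hG hg hq hw hxc hcw h1 (ReturnsLE.of_not hg hw h1 h3)).of_le hcv h2)

/-- The cuts increase with the elements. -/
theorem ReturnsLE.of_lt (hG : H.Def G) (hg : Equivalence G) (hq : H.Def q) (hw : WeakOrder q)
    {x y : X} (hxy : x < y) (h : G x y) : ReturnsLE G q x y := by
  rintro v ⟨hv, w, h1, h2, h3⟩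
  by_contra hn
  have hyv : G y v := hg.trans (hg.symm h) hv
  obtain ⟨z, h4, h5, h6, -⟩ := ReturnsLE.exists_above hG hg hq hw h1 h3
  have hyz : y < z := by
    by_contra hlt
    exact hn (Returns.self hg hw hyv ((h2.trans h4).trans (not_lt.1 hlt)))
  exact hn ((Returns.of_between hG hg hq hw hxy hyz h5 (ReturnsLE.of_not hg hw h5 h6)).of_le hyv
    (h2.trans h4))

theorem ReturnsLE.of_returns (hG : H.Def G) (hg : Equivalence G) (hq : H.Def q) (hw : WeakOrder q)
    {x y : X} (h : Returns G q x y) : ReturnsLE G q y x := by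
  obtain ⟨hGxy, w, h1, h2, h3⟩ := h
  obtain ⟨z, h4, h5, h6, h7⟩ := ReturnsLE.exists_above hG hg hq hw h1 h3
  have hzx : ReturnsLE G q z x := ReturnsLE.of_not hg hw h5 h6
  rcases (h2.trans h4).eq_or_lt with rfl | hyz
  · exact hzx
  exact fun v hv => hzx v (ReturnsLE.of_lt hG hg hq hw hyz (hg.trans (hg.symm hGxy) h5) v hv)

/-- The largest relation outside of which `q` increases, within the classes of `G`. -/
def returnRel (G q : X → X → Prop) : X → X → Prop :=
  fun x y => Returns G q x y ∧ Returns G q y x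

/-- Equality of cuts makes transitivity evident, while the definition by `Returns` gives
definability. -/
theorem returnRel_iff (hG : H.Def G) (hg : Equivalence G) (hq : H.Def q) (hw : WeakOrder q)
    {x y : X} : returnRel G q x y ↔ G x y ∧ ReturnsLE G q x y ∧ ReturnsLE G q y x := by
  constructor
  · rintro ⟨h1, h2⟩
    rcases lt_trichotomy x y with h | rfl | h
    · exact ⟨h1.1, ReturnsLE.of_lt hG hg hq hw h h1.1, ReturnsLE.of_returns hG hg hq hw h1⟩
    · exact ⟨h1.1, fun v hv => hv, fun v hv => hv⟩
    · exact ⟨h1.1, ReturnsLE.of_returns hG hg hq hw h2, ReturnsLE.of_lt hG hg hq hw h h2.1⟩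
  · rintro ⟨h, h1, h2⟩
    exact ⟨h2 y (Returns.self hg hw (hg.refl y) le_rfl),
      h1 x (Returns.self hg hw (hg.refl x) le_rfl)⟩

theorem returnRel_equivalence (hG : H.Def G) (hg : Equivalence G) (hq : H.Def q)
    (hw : WeakOrder q) : Equivalence (returnRel G q) := by
  refine ⟨fun x => ?_, fun h => ⟨h.2, h.1⟩, fun {x y z} h h' => ?_⟩
  · exact ⟨Returns.self hg hw (hg.refl x) le_rfl, Returns.self hg hw (hg.refl x) le_rfl⟩
  · rw [returnRel_iff hG hg hq hw] at h h' ⊢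
    exact ⟨hg.trans h.1 h'.1, fun v hv => h'.2.1 v (h.2.1 v hv), fun v hv => h.2.2 v (h'.2.2 v hv)⟩

theorem returnRel_def (hG : H.Def G) (hg : Equivalence G) (hq : H.Def q) (hw : WeakOrder q) :
    H.Def (returnRel G q) :=
  (Returns.def hG hg hq hw).and (H.def_flip (Returns.def hG hg hq hw))

theorem returnRel_lt {x : X} (h : EventuallyAbove G q x) : returnRel G q < G := by
  refine ⟨fun a b hab => hab.1.1, fun hle => ?_⟩
  obtain ⟨w, h1, h2⟩ := h
  obtain ⟨z, h3, h4, h5⟩ := (hle x w h1).1.2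
  exact h5 (h2 z h3 h4)

theorem incomp_le_returnRel (hg : Equivalence G) (h : Incomp q ≤ G) :
    Incomp q ≤ returnRel G q := fun a b hab =>
  ⟨Returns.of_not (h a b hab) hab.1, Returns.of_not (hg.symm (h a b hab)) hab.2⟩

theorem increasing_off_returnRel (hg : Equivalence G) (hw : WeakOrder q) {x y : X} (hxy : x < y)
    (h : G x y) (hn : ¬ returnRel G q x y) : q x y := by
  by_contra hnq
  exact hn ⟨Returns.of_not h hnq, Returns.self hg hw (hg.symm h) hxy.le⟩

/-- The point z witnessing the return is not q-above x. Were it incomparable to x, convexity of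
incomparability would make y incomparable to x as well. -/
theorem exists_decreasing_in_returnRel (hg : Equivalence G) (hq : H.Def q) (hw : WeakOrder q)
    {x y : X} (hxy : x < y) (h : returnRel G q x y) (hn : ¬ Incomp q x y) :
    ∃ z, y ≤ z ∧ returnRel G q x z ∧ q z x := by
  obtain ⟨⟨h0, z, h1, h2, h3⟩, -⟩ := h
  refine ⟨z, h2, ⟨Returns.of_not h1 h3,
    Returns.self hg hw (hg.symm h1) (hxy.le.trans h2)⟩, ?_⟩
  by_contra h4
  exact hn (hq.incomp.convex hw.equivalence hxy.le h2 ⟨h3, h4⟩)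

/-- Within classes of `G`, one of the two signs is the eventual one. -/
theorem eventuallyAbove_or (hG : H.Def G) (hg : Equivalence G) (hq : H.Def q) (hw : WeakOrder q)
    (hlt : Incomp q < G) (x : X) :
    EventuallyAbove G q x ∨ EventuallyAbove G (fun a b => q b a) x := by
  have hY : {z | G x z ∧ q x z} ∈ H.paramDef := H.def_fibre (hG.and hq) x
  -- If points q-above x are cofinal in the class, convexity from some point on makes them all of
  -- its end. Otherwise the end contains none, and beyond the convex incomparability class of x only
  -- points q-below x remain.
  by_cases hcof : ∀ w, G x w → ∃ z, w ≤ z ∧ G x z ∧ q x z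
  · obtain ⟨z, -, hz⟩ := hcof x (hg.refl x)
    obtain ⟨c, hc, hcc⟩ := (H.joins hY).exists_final_convex ⟨z, hz⟩
    refine Or.inl ⟨c, hc.1, fun y hy hcy => ?_⟩
    obtain ⟨z', h1, h2⟩ := hcof y hy
    rcases hcy.eq_or_lt with rfl | hcy
    · exact hc.2
    rcases h1.eq_or_lt with rfl | h1
    · exact h2.2
    · exact (hcc z' h2 y hcy h1).2
  · push Not at hcof
    obtain ⟨w, hw1, hw2⟩ := hcof
    obtain ⟨y, h1, h2, h3⟩ := hq.incomp.exists_right hG hw.equivalence hg hlt.2 x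
    refine Or.inr ⟨max w y, ?_, fun z hz hle => ?_⟩
    · rcases max_choice w y with h | h <;> rw [h] <;> assumption
    · by_contra hn
      exact h3 (hq.incomp.convex hw.equivalence h1.le ((le_max_right _ _).trans hle)
        ⟨hw2 z ((le_max_left _ _).trans hle) hz, hn⟩)

end Returns

end HomogeneousOrder

/-! ### Existence of the sequence, by descent with alternating signs. -/

namespace HomogeneousOrder

variable {X : Type*} [LinearOrder X] {H : HomogeneousOrder X} {q : X → X → Prop}

/-- One step down from `G`: outside of `E` and inside `G` the relation `q` increases, and inside
`E` it eventually decreases, unless `E` is trivial. -/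
theorem exists_step_down {G : X → X → Prop} (hG : H.Def G) (hg : Equivalence G) (hq : H.Def q)
    (hw : WeakOrder q) (hlt : Incomp q < G) (h : ∀ x, EventuallyAbove G q x) [Nonempty X] :
    ∃ E, H.Def E ∧ Equivalence E ∧ E < G ∧ (∀ x y, x < y → G x y → ¬ E x y → q x y) ∧
      (E = Incomp q ∨ (Incomp q < E ∧ ∀ x, EventuallyAbove E (fun a b => q b a) x)) := by
  obtain ⟨x⟩ := ‹Nonempty X›
  have hE := returnRel_def hG hg hq hw
  have he := returnRel_equivalence hG hg hq hw
  have hle := incomp_le_returnRel hg hlt.le (q := q)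
  refine ⟨returnRel G q, hE, he, returnRel_lt (h x),
    fun a b hab h1 h2 => increasing_off_returnRel hg hw hab h1 h2, ?_⟩
  rcases hle.eq_or_lt with heq | hlt'
  · exact Or.inl heq.symm
  refine Or.inr ⟨hlt', fun y => ?_⟩
  rcases eventuallyAbove_or hE he hq hw hlt' y with ⟨c, hc1, hc2⟩ | h'
  -- The old sign cannot be eventual inside E: points q-below the base point occur arbitrarily high
  -- in its class.
  · exfalso
    obtain ⟨d, hd1, hd2, hd3⟩ := hq.incomp.exists_right hE hw.equivalence he hlt'.2 y
    have hm : returnRel G q y (max c d) := by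
      rcases max_choice c d with h | h <;> rw [h] <;> assumption
    have hn : ¬ Incomp q y (max c d) := fun hi =>
      hd3 (hq.incomp.convex hw.equivalence hd1.le (le_max_right _ _) hi)
    obtain ⟨z, h1, h2, h3⟩ := exists_decreasing_in_returnRel hg hq hw
      (lt_of_lt_of_le hd1 (le_max_right c d)) hm hn
    exact hw.asymm h3 (hc2 z h2 ((le_max_left _ _).trans h1))
  · exact h'

theorem signed_def (hq : H.Def q) (b : Bool) : H.Def (signed q b) := by
  cases b
  · exact H.def_flip hq
  · exact hq

/-- There is no infinite descent with alternating signs. -/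
theorem no_alternating_descent [Nonempty X] (hq : H.Def q) (hw : WeakOrder q)
    (G : ℕ → X → X → Prop) (s : ℕ → Bool) (hG : ∀ i, H.Def (G i)) (hg : ∀ i, Equivalence (G i))
    (hlt : ∀ i, G (i + 1) < G i) (hs : ∀ i, s (i + 1) = !(s i))
    (hsign : ∀ i x y, x < y → G i x y → ¬ G (i + 1) x y → signed q (s i) x y) : False := by
  obtain ⟨x⟩ := ‹Nonempty X›
  have hright := fun i => (hG (i + 1)).exists_right (hG i) (hg (i + 1)) (hg i) (hlt i).2 x
  choose y hxy h1 h2 using hright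
  have hGanti : Antitone G := antitone_nat_of_succ_le fun i => (hlt i).le
  have hyanti : StrictAnti y := strictAnti_nat_of_succ_lt fun i => by
    by_contra hle
    exact h2 i ((hG (i + 1)).convex (hg (i + 1)) (hxy i).le (not_lt.1 hle) (h1 (i + 1)))
  have hs2 : ∀ i, s (2 * i) = s 0 := by
    intro i
    induction i with
    | zero => rfl
    | succ i ih => rw [show 2 * (i + 1) = 2 * i + 1 + 1 by ring, hs, hs, ih, Bool.not_not]
  -- The even terms lie on one q-side of x, and the odd terms between them on the other.
  obtain ⟨i, j, hij, hb⟩ := H.joins (H.def_fibre (signed_def hq (s 0)) x) (fun i => y (2 * i))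
    (fun i => by have := hsign (2 * i) x _ (hxy _) (h1 _) (h2 _); rwa [hs2] at this)
  have hmid := hb (y (2 * i + 1)) (Or.inr ⟨hyanti (by omega), hyanti (by omega)⟩)
  have hmid' := hsign (2 * i + 1) x _ (hxy _) (h1 _) (h2 _)
  rw [hs, hs2, signed_not] at hmid'
  exact (signed_weakOrder hw (s 0)).asymm hmid hmid'

/-- `Es` starts with the incomparability relation of `q`, and `q` increases for the iterated
reversal, within the classes of `G`. -/
structure Represents (H : HomogeneousOrder X) (q G : X → X → Prop)
    (Es : List (X → X → Prop)) : Prop where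
  head : Es.head? = some (Incomp q)
  chain : Es.Pairwise (· < ·)
  mem_def : ∀ E ∈ Es, H.Def E ∧ Equivalence E
  increasing : ∀ x y, G x y → ¬ Incomp q x y → reverseInSeq (· < ·) Es x y → q x y

/-- Outside E no member acts, so the order is the original one. Inside E the final reversal turns a
representation of the converse of q into one of q. -/
theorem Represents.append_flip {E G : X → X → Prop} {Es : List (X → X → Prop)}
    (h : Represents H (fun x y => q y x) E Es) (hE : H.Def E) (he : Equivalence E)
    (hlt : ∀ F ∈ Es, F < E) (hoff : ∀ x y, x < y → G x y → ¬ E x y → q x y) :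
    Represents H q G (Es ++ [E]) := by
  have hinc : Incomp (fun x y => q y x) = Incomp q := signed_incomp q false
  refine ⟨?_, ?_, ?_, ?_⟩
  · rw [List.head?_append, h.head, hinc]; rfl
  · rw [List.pairwise_append]
    exact ⟨h.chain, by simp, by simpa using hlt⟩
  · intro F hF
    rcases List.mem_append.1 hF with hF | hF
    · exact h.mem_def F hF
    · rw [List.mem_singleton.1 hF]; exact ⟨hE, he⟩
  · intro x y hGxy hn hr
    have hr' : reverseIn (reverseInSeq (· < ·) Es) E x y := by
      simpa [reverseInSeq] using hr
    rcases hr' with ⟨h1, h2⟩ | ⟨h1, h2⟩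
    · exact h.increasing y x (he.symm h1) (by rw [hinc]; exact fun hi => hn ⟨hi.2, hi.1⟩) h2
    · rw [reverseInSeq_iff _ _ (fun F hF _ _ => (h.mem_def F hF).2.symm),
        relCount_eq_zero fun F hF hxy => h1 ((hlt F hF).le _ _ hxy)] at h2
      exact hoff x y (by simpa using h2) hGxy h1

/-- A counterexample yields a smaller one with the opposite sign, against `no_alternating_descent`.
The bound E < G on the members is what allows G to be appended afterwards. -/
theorem exists_represents [Nonempty X] (hq : H.Def q) (hw : WeakOrder q) (b : Bool)
    {G : X → X → Prop} (hG : H.Def G) (hg : Equivalence G) (hlt : Incomp q < G)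
    (h : ∀ x, EventuallyAbove G (signed q b) x) :
    ∃ Es, Represents H (signed q b) G Es ∧ ∀ E ∈ Es, E < G := by
  by_contra hcon
  let Bad := {P : (X → X → Prop) × Bool // H.Def P.1 ∧ Equivalence P.1 ∧ Incomp q < P.1 ∧
    (∀ x, EventuallyAbove P.1 (signed q P.2) x) ∧
    ¬ ∃ Es, Represents H (signed q P.2) P.1 Es ∧ ∀ E ∈ Es, E < P.1}
  have hstep : ∀ P : Bad, ∃ P' : Bad, P'.1.1 < P.1.1 ∧ P'.1.2 = !P.1.2 ∧
      ∀ x y, x < y → P.1.1 x y → ¬ P'.1.1 x y → signed q P.1.2 x y := by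
    rintro ⟨⟨G, b⟩, hG, hg, hlt, h, hcon⟩
    obtain ⟨E, hE, he, hEG, hoff, hor⟩ := exists_step_down hG hg (signed_def hq b)
      (signed_weakOrder hw b) (by rwa [signed_incomp]) h
    rw [signed_incomp] at hor
    rcases hor with rfl | ⟨hlt', hev⟩
    · exfalso
      refine hcon ⟨[Incomp q], ⟨by simp [signed_incomp], by simp, ?_, ?_⟩, by simpa using hEG⟩
      · simpa using ⟨hE, he⟩
      · intro x y hxy hn hr
        rw [signed_incomp] at hn
        have hr' : reverseIn (· < ·) (Incomp q) x y := hr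
        rcases hr' with ⟨h1, -⟩ | ⟨-, h2⟩
        · exact absurd h1 hn
        · exact hoff x y h2 hxy hn
    · rw [← signed_not] at hev
      refine ⟨⟨⟨E, !b⟩, hE, he, hlt', hev, ?_⟩, hEG, rfl, hoff⟩
      rintro ⟨Es, hr, hall⟩
      refine hcon ⟨Es ++ [E], Represents.append_flip ?_ hE he hall hoff, ?_⟩
      · rw [← signed_not]; exact hr
      · intro F hF
        rcases List.mem_append.1 hF with hF | hF
        · exact (hall F hF).trans hEG
        · rw [List.mem_singleton.1 hF]; exact hEG
  choose nxt n1 n2 n3 using hstep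
  let a : ℕ → Bad := fun i => nxt^[i] ⟨⟨G, b⟩, hG, hg, hlt, h, hcon⟩
  have ha : ∀ i, a (i + 1) = nxt (a i) := fun i => Function.iterate_succ_apply' _ _ _
  refine no_alternating_descent hq hw (fun i => (a i).1.1) (fun i => (a i).1.2)
    (fun i => (a i).2.1) (fun i => (a i).2.2.1) (fun i => ?_) (fun i => ?_) (fun i x y => ?_)
  · simp only [ha]; exact n1 _
  · simp only [ha]; exact n2 _
  · simp only [ha]; exact n3 _ x y

/-- Existence of the sequence of equivalence relations in the weak monotonicity theorem. -/
theorem exists_represents_top [Nonempty X] (hq : H.Def q) (hw : WeakOrder q)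
    (hne : ∃ x y, ¬ Incomp q x y) :
    ∃ Es, Represents H q (fun _ _ => True) Es := by
  have huniv : Set.univ ∈ H.paramDef := by
    obtain ⟨x⟩ := ‹Nonempty X›
    have h1 := H.def_fibre hq x
    have := H.paramDef_union h1 (H.paramDef_compl h1)
    rwa [Set.union_compl_self] at this
  have hT : H.Def (fun _ _ : X => True) := H.def_of (fun _ => Iff.rfl) (fun _ => huniv)
  have ht : Equivalence (fun _ _ : X => True) := ⟨fun _ => trivial, fun _ => trivial,
    fun _ _ => trivial⟩
  have hlt : Incomp q < (fun _ _ : X => True) := by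
    refine ⟨fun _ _ _ => trivial, fun hle => ?_⟩
    obtain ⟨x, y, h⟩ := hne
    exact h (hle x y trivial)
  obtain ⟨x⟩ := ‹Nonempty X›
  rcases eventuallyAbove_or hT ht hq hw hlt x with h | h
  · obtain ⟨Es, h1, -⟩ := exists_represents hq hw true hT ht hlt (h.transfer hT hq)
    exact ⟨Es, h1⟩
  -- If q is eventually decreasing, the converse is represented instead and the full relation is
  -- appended to reverse everything once more.
  · obtain ⟨Es, h1, h2⟩ := exists_represents hq hw false hT ht hlt
      (h.transfer hT (H.def_flip hq))
    exact ⟨_, h1.append_flip hT ht h2 fun _ _ _ _ hn => absurd trivial hn⟩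

/-! ### Uniqueness -/

theorem exists_strict_bound [Nonempty X] {E E' : X → X → Prop} (hE : H.Def E) (he : Equivalence E)
    (hlt : E < E') (l : List (X → X → Prop))
    (hl : ∀ F ∈ l, (H.Def F ∧ Equivalence F) ∧ F < E') :
    ∃ B, H.Def B ∧ Equivalence B ∧ B < E' ∧ E ≤ B ∧ ∀ F ∈ l, F ≤ B := by
  induction l with
  | nil => exact ⟨E, hE, he, hlt, le_rfl, by simp⟩
  | cons F l ih =>
    obtain ⟨B, h1, h2, h3, h4, h5⟩ := ih fun F hF => hl F (by simp [hF])
    obtain ⟨⟨hF, hf⟩, hFE⟩ := hl F (by simp)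
    rcases Def.comparable h1 hF h2 hf with h | h
    · refine ⟨F, hF, hf, hFE, h4.trans h, ?_⟩
      simpa using fun F' hF' => (h5 F' hF').trans h
    · refine ⟨B, h1, h2, h3, h4, ?_⟩
      simpa using ⟨h, h5⟩

/-- Two chains with the same smallest member and the same iterated reversals (outside of the
smallest member) cannot have strictly comparable largest members. -/
theorem not_last_lt [Nonempty X] {E₀ E E' : X → X → Prop} {l l' : List (X → X → Prop)}
    (hl : ∀ F ∈ l ++ [E], H.Def F ∧ Equivalence F) (hl' : ∀ F ∈ l' ++ [E'], H.Def F ∧ Equivalence F)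
    (hc : (l ++ [E]).Pairwise (· < ·)) (hc' : (l' ++ [E']).Pairwise (· < ·))
    (h0 : E₀ ≤ E)
    (h : ∀ x y, ¬ E₀ x y → (reverseInSeq (· < ·) (l ++ [E]) x y ↔
      reverseInSeq (· < ·) (l' ++ [E']) x y)) (hlt : E < E') : False := by
  rw [List.pairwise_append] at hc hc'
  obtain ⟨x⟩ := ‹Nonempty X›
  obtain ⟨hE, he⟩ := hl E (by simp)
  obtain ⟨hE', he'⟩ := hl' E' (by simp)
  obtain ⟨B, h1, h2, h3, h4, h5⟩ := exists_strict_bound hE he hlt l' fun F hF =>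
    ⟨hl' F (by simp [hF]), hc'.2.2 F hF E' (by simp)⟩
  -- This pair is related by no member of the first chain and only by E' in the second.
  obtain ⟨y, hxy, h6, h7⟩ := h1.exists_right hE' h2 he' h3.2 x
  have hiff := h x y (fun h => h7 (h4 _ _ (h0 _ _ h)))
  rw [reverseInSeq_concat_iff (E := E'),
    reverseInSeq_iff _ _ (fun F hF _ _ => (hl F hF).2.symm),
    reverseInSeq_iff _ _ (fun F hF _ _ => (hl' F (by simp [hF])).2.symm),
    relCount_eq_zero, relCount_eq_zero] at hiff
  · have := hiff.1 (by simpa using hxy)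
    rcases this with h | h
    · exact absurd hxy (not_lt.2 (le_of_lt (by simpa using h.2)))
    · exact h.1 h6
  · intro F hF hyx
    exact h7 (h2.symm (h5 F hF _ _ hyx))
  · intro F hF hF'
    refine h7 (h4 _ _ ?_)
    rcases List.mem_append.1 hF with hF | hF
    · exact (hc.2.2 F hF E (by simp)).le _ _ hF'
    · rwa [List.mem_singleton.1 hF] at hF'

theorem head_le_last {α : Type*} [Preorder α] {a b : α} {l : List α}
    (h : (l ++ [b]).head? = some a) (hc : (l ++ [b]).Pairwise (· < ·)) : a ≤ b := by
  cases l with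
  | nil => simp at h; exact h.ge
  | cons c l =>
    simp only [List.cons_append, List.head?_cons, Option.some.injEq] at h
    subst h
    rw [List.cons_append, List.pairwise_cons] at hc
    exact (hc.1 b (by simp)).le

theorem eq_nil_of_concat {α : Type*} [Preorder α] {a : α} {l : List α}
    (h : (l ++ [a]).head? = some a) (hc : (l ++ [a]).Pairwise (· < ·)) : l = [] := by
  cases l with
  | nil => rfl
  | cons c l =>
    simp only [List.cons_append, List.head?_cons, Option.some.injEq] at h
    subst h
    rw [List.cons_append, List.pairwise_cons] at hc
    exact absurd (hc.1 c (by simp)) (lt_irrefl _)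

/-- The last members agree by `not_last_lt`. Reversal in a common last member can be undone, so the
shortened chains still agree off E₀. -/
theorem chain_unique [Nonempty X] {E₀ : X → X → Prop} {l l' : List (X → X → Prop)}
    (hh : l.head? = some E₀) (hh' : l'.head? = some E₀)
    (hl : ∀ F ∈ l, H.Def F ∧ Equivalence F) (hl' : ∀ F ∈ l', H.Def F ∧ Equivalence F)
    (hc : l.Pairwise (· < ·)) (hc' : l'.Pairwise (· < ·))
    (h : ∀ x y, ¬ E₀ x y → (reverseInSeq (· < ·) l x y ↔ reverseInSeq (· < ·) l' x y)) :
    l = l' := by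
  induction l using List.reverseRecOn generalizing l' with
  | nil => simp at hh
  | append_singleton l E ih =>
    rcases List.eq_nil_or_concat' l' with rfl | ⟨l', E', rfl⟩
    · simp at hh'
    have hEE' : E = E' := by
      obtain ⟨hE, he⟩ := hl E (by simp)
      obtain ⟨hE', he'⟩ := hl' E' (by simp)
      rcases Def.comparable hE hE' he he' with h1 | h1
      · rcases h1.eq_or_lt with h1 | h1
        · exact h1
        · exact (not_last_lt hl hl' hc hc' (head_le_last hh hc) h h1).elim
      · rcases h1.eq_or_lt with h1 | h1
        · exact h1.symm
        · exact (not_last_lt hl' hl hc' hc (head_le_last hh' hc')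
            (fun x y hn => (h x y hn).symm) h1).elim
    subst hEE'
    rcases l.eq_nil_or_concat' with rfl | ⟨t, F, rfl⟩
    · simp only [List.nil_append, List.head?_cons, Option.some.injEq] at hh
      subst hh
      rw [eq_nil_of_concat hh' hc']
    rcases l'.eq_nil_or_concat' with rfl | ⟨t', F', rfl⟩
    · simp only [List.nil_append, List.head?_cons, Option.some.injEq] at hh'
      subst hh'
      exact absurd (eq_nil_of_concat hh hc) (by simp)
    obtain ⟨hE, he⟩ := hl E (by simp)
    rw [ih (l' := t' ++ [F'])]
    · rwa [List.head?_append_of_ne_nil _ (by simp)] at hh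
    · rwa [List.head?_append_of_ne_nil _ (by simp)] at hh'
    · exact fun F hF => hl F (List.mem_append_left _ hF)
    · exact fun F hF => hl' F (List.mem_append_left _ hF)
    · exact (List.pairwise_append.1 hc).1
    · exact (List.pairwise_append.1 hc').1
    · intro x y hn
      by_cases hxy : E x y
      · have hyx := he.symm hxy
        have hn' : ¬ E₀ y x := by
          have hmem : E₀ ∈ t ++ [F] ++ [E] := List.mem_of_head? hh
          exact fun h0 => hn ((hl E₀ hmem).2.symm h0)
        have := h y x hn'
        rw [reverseInSeq_concat_iff (E := E), reverseInSeq_concat_iff (E := E)] at this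
        simpa [hyx] using this
      · have := h x y hn
        rw [reverseInSeq_concat_iff (E := E), reverseInSeq_concat_iff (E := E)] at this
        simpa [hxy] using this

theorem reverseInSeq_total {l : List (X → X → Prop)} (hl : ∀ F ∈ l, ∀ x y, F x y → F y x)
    {x y : X} (h : x ≠ y) : reverseInSeq (· < ·) l x y ∨ reverseInSeq (· < ·) l y x := by
  have hc : relCount l y x = relCount l x y :=
    relCount_congr fun F hF => ⟨hl F hF y x, hl F hF x y⟩
  rw [reverseInSeq_iff _ _ hl, reverseInSeq_iff _ _ hl, hc]
  split_ifs
  · exact lt_or_gt_of_ne h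
  · exact (lt_or_gt_of_ne h).symm

theorem Represents.iff (hw : WeakOrder q) {Es : List (X → X → Prop)}
    (h : Represents H q (fun _ _ => True) Es) {x y : X} (hn : ¬ Incomp q x y) :
    reverseInSeq (· < ·) Es x y ↔ q x y := by
  refine ⟨h.increasing x y trivial hn, fun hq => ?_⟩
  have hne : x ≠ y := by rintro rfl; exact hw.irrefl x hq
  rcases reverseInSeq_total (fun F hF _ _ => (h.mem_def F hF).2.symm) hne with h1 | h1
  · exact h1
  · exact absurd hq (hw.asymm (h.increasing y x trivial (fun hi => hn ⟨hi.2, hi.1⟩) h1))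

theorem Represents.unique [Nonempty X] (hw : WeakOrder q) {Es Es' : List (X → X → Prop)}
    (h : Represents H q (fun _ _ => True) Es) (h' : Represents H q (fun _ _ => True) Es') :
    Es = Es' :=
  chain_unique h.head h'.head h.mem_def h'.mem_def h.chain h'.chain
    fun _ _ hn => (h.iff hw hn).trans (h'.iff hw hn).symm

theorem Represents.incomp_le {Es : List (X → X → Prop)} {G : X → X → Prop}
    (h : Represents H q G Es) {E : X → X → Prop} (hE : E ∈ Es) : Incomp q ≤ E := by
  obtain ⟨t, rfl⟩ : ∃ t, Es = Incomp q :: t := by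
    have := h.head
    cases Es <;> simp_all
  rcases List.mem_cons.1 hE with rfl | hE
  · exact le_rfl
  · exact ((List.pairwise_cons.1 h.chain).1 E hE).le

/-- The classes of the members of a representing sequence are also convex with respect to `q`. -/
theorem Represents.q_convex (hw : WeakOrder q) {Es : List (X → X → Prop)}
    (h : Represents H q (fun _ _ => True) Es) {E : X → X → Prop} (hE : E ∈ Es) {x y z : X}
    (hxy : ¬ q y x) (hyz : ¬ q z y) (hxz : E x z) : E x y := by
  by_contra hn
  obtain ⟨hEd, he⟩ := h.mem_def E hE
  have : Nonempty X := ⟨x⟩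
  have hcomp : ∀ F ∈ Es, F ≤ E ∨ E ≤ F := fun F hF =>
    Def.comparable (h.mem_def F hF).1 hEd (h.mem_def F hF).2 he
  have hnz : ¬ E z y := fun hzy => hn (he.trans hxz hzy)
  have hle : Incomp q ≤ E := h.incomp_le hE
  -- Seen from y outside their E-class, x and z are related to y by the same members and lie on the
  -- same side, so the iterated order cannot put y between them.
  have hcount : relCount Es x y = relCount Es z y := relCount_congr fun F hF => by
    have hf := (h.mem_def F hF).2
    rcases hcomp F hF with h1 | h1
    · exact iff_of_false (fun h => hn (h1 _ _ h)) (fun h => hnz (h1 _ _ h))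
    · have := h1 _ _ hxz
      exact ⟨fun h => hf.trans (hf.symm this) h, fun h => hf.trans this h⟩
  have hord : (x < y ↔ z < y) ∧ (y < x ↔ y < z) := by
    have hne1 : x ≠ y := by rintro rfl; exact hn (he.refl _)
    have hne2 : z ≠ y := by rintro rfl; exact hnz (he.refl _)
    rcases lt_or_gt_of_ne hne1 with h1 | h1 <;> rcases lt_or_gt_of_ne hne2 with h2 | h2
    · exact ⟨iff_of_true h1 h2, iff_of_false h1.asymm h2.asymm⟩
    · exact absurd (hEd.convex he h1.le h2.le hxz) hn
    · exact absurd (hEd.convex he h2.le h1.le (he.symm hxz)) hnz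
    · exact ⟨iff_of_false h1.asymm h2.asymm, iff_of_true h1 h2⟩
  have hsym := fun F hF x y => (h.mem_def F hF).2.symm (x := x) (y := y)
  have hxy' : q x y := by
    by_contra h'
    exact hn (hle _ _ ⟨h', hxy⟩)
  have hq1 := (h.iff hw (fun h => hn (hle _ _ h))).2 hxy'
  have hq2 : reverseInSeq (· < ·) Es z y := by
    rw [reverseInSeq_iff _ _ hsym] at hq1 ⊢
    rwa [← hcount, ← hord.1, ← hord.2]
  exact hyz ((h.iff hw (fun h => hnz (hle _ _ h))).1 hq2)

end HomogeneousOrder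

namespace SortedLanguage

/-! ### Substitution -/

section Substitution

variable {L : SortedLanguage.{u, v, w}}

/-- Substitution of terms for the variables of a term. -/
def Term.subst {α β : Type*} {σ : α → L.Sorts} {τ : β → L.Sorts} (ts : ∀ i, Term L τ (σ i)) :
    {s : L.Sorts} → Term L σ s → Term L τ s
  | _, .var i => ts i
  | _, .func f us => .func f (fun i => (us i).subst ts)

/-- The substitution that leaves a new variable alone. -/
def liftSubst {α β : Type*} {σ : α → L.Sorts} {τ : β → L.Sorts} (s : L.Sorts)
    (ts : ∀ i, Term L τ (σ i)) : ∀ i, Term L (extendSorts s τ) (extendSorts s σ i)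
  | none => .var (σ := extendSorts s τ) none
  | some i => (ts i).subst (fun j => .var (σ := extendSorts s τ) (some j))

/-- Substitution of terms for the free variables of a formula. -/
def Formula.subst : {α : Type m} → {σ : α → L.Sorts} → Formula L σ →
    {β : Type m} → {τ : β → L.Sorts} → (∀ i, Term L τ (σ i)) → Formula L τ
  | _, _, .falsum, _, _, _ => .falsum
  | _, _, .equal t₁ t₂, _, _, ts => .equal (t₁.subst ts) (t₂.subst ts)
  | _, _, .rel R us, _, _, ts => .rel R (fun i => (us i).subst ts)
  | _, _, .imp φ ψ, _, _, ts => .imp (φ.subst ts) (ψ.subst ts)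
  | _, _, .all s φ, _, _, ts => .all s (φ.subst (liftSubst s ts))

variable {M : L.Sorts → Type m} [L.Structure M]

theorem Term.eval_subst {α β : Type*} {σ : α → L.Sorts} {τ : β → L.Sorts}
    (ts : ∀ i, Term L τ (σ i)) (v : Tuple M τ) {s : L.Sorts} (t : Term L σ s) :
    (t.subst ts).eval v = t.eval (fun i => (ts i).eval v) := by
  induction t with
  | var i => rfl
  | func f us ih =>
    simp only [Term.subst, Term.eval]
    congr 1
    funext i
    exact ih i

theorem Formula.realize_subst {α : Type*} {σ : α → L.Sorts} (φ : Formula L σ)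
    {β : Type _} {τ : β → L.Sorts} (ts : ∀ i, Term L τ (σ i)) (v : Tuple M τ) :
    (φ.subst ts).Realize v ↔ φ.Realize (fun i => (ts i).eval v) := by
  induction φ generalizing β with
  | falsum => rfl
  | equal t₁ t₂ => simp only [Formula.subst, Formula.Realize, Term.eval_subst]
  | rel R us => simp only [Formula.subst, Formula.Realize, Term.eval_subst]
  | imp φ ψ ih₁ ih₂ => simp only [Formula.subst, Formula.Realize, ih₁, ih₂]
  | all s φ ih =>
    simp only [Formula.subst, Formula.Realize, ih]
    refine forall_congr' fun a => ?_
    have : (fun i => (liftSubst s ts i).eval (extendTuple a v)) =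
        extendTuple a (fun i => (ts i).eval v) := by
      funext i
      cases i with
      | none => rfl
      | some i => exact Term.eval_subst _ _ _
    rw [this]

/-- A term as a term in more variables. -/
def Term.weaken {α β : Type*} {τ : β → L.Sorts} (σ : α → L.Sorts) {s : L.Sorts}
    (t : Term L τ s) : Term L (Sum.elim σ τ) s :=
  t.subst fun j => .var (σ := Sum.elim σ τ) (Sum.inr j)

theorem Term.eval_weaken {α β : Type*} {σ : α → L.Sorts} {τ : β → L.Sorts} (v : Tuple M σ)
    (y : Tuple M τ) {s : L.Sorts} (t : Term L τ s) :
    (t.weaken σ).eval (v.append y) = t.eval y :=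
  Term.eval_subst (fun j => .var (σ := Sum.elim σ τ) (Sum.inr j)) (v.append y) t

end Substitution

section Tuples

variable {L : SortedLanguage.{u, v, w}} {M : L.Sorts → Type m} {α β : Type} {ρ : α → L.Sorts}
  {κ : β → L.Sorts}

/-- The first part of a concatenation. -/
def Tuple.fst (v : Tuple M (Sum.elim ρ κ)) : Tuple M ρ := fun i => v (Sum.inl i)

/-- The second part of a concatenation. -/
def Tuple.snd (v : Tuple M (Sum.elim ρ κ)) : Tuple M κ := fun i => v (Sum.inr i)

@[simp] theorem Tuple.snd_append (v : Tuple M ρ) (w : Tuple M κ) : (v.append w).snd = w := rfl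

theorem Tuple.append_fst_snd (v : Tuple M (Sum.elim ρ κ)) : Tuple.append v.fst v.snd = v := by
  funext i
  cases i <;> rfl

end Tuples

/-! ### Closure properties of definable sets -/

section Definable

variable {L : SortedLanguage.{u, v, w}} {M : L.Sorts → Type m} [L.Structure M]
  {A : ∀ s, Set (M s)} {α β γ : Type} {ρ : α → L.Sorts} {κ : β → L.Sorts} {θ : γ → L.Sorts}

variable (L) in
/-- The coordinates of `h` are given by terms. -/
def IsTermMap (h : Tuple M κ → Tuple M ρ) : Prop :=
  ∀ i, ∃ t : Term L κ (ρ i), ∀ v, h v i = t.eval v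

theorem IsTermMap.id : IsTermMap L (fun v : Tuple M ρ => v) := fun i => ⟨.var i, fun _ => rfl⟩

theorem IsTermMap.comp {g : Tuple M κ → Tuple M ρ} {h : Tuple M θ → Tuple M κ}
    (hg : IsTermMap L g) (hh : IsTermMap L h) : IsTermMap L (fun v => g (h v)) := by
  intro i
  obtain ⟨t, ht⟩ := hg i
  choose us hus using hh
  refine ⟨t.subst us, fun v => (ht _).trans ?_⟩
  rw [Term.eval_subst]
  congr 1
  funext j
  exact hus j v

theorem IsTermMap.fst {h : Tuple M θ → Tuple M (Sum.elim ρ κ)} (hh : IsTermMap L h) :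
    IsTermMap L (fun v => (h v).fst) := fun i => hh (Sum.inl i)

theorem IsTermMap.snd {h : Tuple M θ → Tuple M (Sum.elim ρ κ)} (hh : IsTermMap L h) :
    IsTermMap L (fun v => (h v).snd) := fun i => hh (Sum.inr i)

theorem IsTermMap.append {g : Tuple M θ → Tuple M ρ} {h : Tuple M θ → Tuple M κ}
    (hg : IsTermMap L g) (hh : IsTermMap L h) : IsTermMap L (fun v => (g v).append (h v)) := by
  rintro (i | i)
  · exact hg i
  · exact hh i

variable (A) in
/-- A predicate of tuples that defines an `A`-definable set. -/
def DefPred (P : Tuple M ρ → Prop) : Prop := DefinableOver L A {v | P v}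

theorem DefPred.congr {P Q : Tuple M ρ → Prop} (h : DefPred A P) (hPQ : ∀ v, P v ↔ Q v) :
    DefPred A Q := by
  obtain ⟨φ, hφ⟩ := h
  exact ⟨φ, fun v => (hPQ v).symm.trans (hφ v)⟩

theorem DefPred.falsum : DefPred A (fun _ : Tuple M ρ => False) :=
  ⟨Formula.falsum, fun _ => Iff.rfl⟩

theorem DefPred.imp {P Q : Tuple M ρ → Prop} (hP : DefPred A P) (hQ : DefPred A Q) :
    DefPred A (fun v => P v → Q v) := by
  obtain ⟨φ, hφ⟩ := hP
  obtain ⟨ψ, hψ⟩ := hQ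
  exact ⟨φ.imp ψ, fun v => imp_congr (hφ v) (hψ v)⟩

theorem DefPred.not {P : Tuple M ρ → Prop} (hP : DefPred A P) : DefPred A (fun v => ¬ P v) :=
  hP.imp DefPred.falsum

theorem DefPred.and {P Q : Tuple M ρ → Prop} (hP : DefPred A P) (hQ : DefPred A Q) :
    DefPred A (fun v => P v ∧ Q v) :=
  (hP.imp hQ.not).not.congr fun v => by tauto

theorem DefPred.or {P Q : Tuple M ρ → Prop} (hP : DefPred A P) (hQ : DefPred A Q) :
    DefPred A (fun v => P v ∨ Q v) :=
  (hP.not.imp hQ).congr fun v => by tauto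

/-- One closure property covering every permutation, repetition and omission of coordinates. -/
theorem DefPred.comp {P : Tuple M ρ → Prop} (hP : DefPred A P) {h : Tuple M κ → Tuple M ρ}
    (hh : IsTermMap L h) : DefPred A (fun v => P (h v)) := by
  obtain ⟨φ, hφ⟩ := hP
  choose ts hts using hh
  let us : ∀ i, Term L (Sum.elim (paramSort A) κ) (Sum.elim (paramSort A) ρ i) := fun i =>
    match i with
    | Sum.inl c => .var (σ := Sum.elim (paramSort A) κ) (Sum.inl c)
    | Sum.inr i => (ts i).weaken (paramSort A)
  refine ⟨Formula.subst φ us, fun v => (hφ (h v)).trans ?_⟩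
  unfold FormulaOver.Holds
  rw [Formula.realize_subst]
  refine iff_of_eq (congrArg _ ?_)
  funext i
  rcases i with c | i
  · rfl
  · exact (hts i v).trans (Term.eval_weaken _ _ (ts i)).symm

theorem DefPred.exists_one {s : L.Sorts} {P : Tuple M (extendSorts s ρ) → Prop}
    (hP : DefPred A P) : DefPred A (fun v => ∃ a : M s, P (extendTuple a v)) := by
  have hall : ∀ {Q : Tuple M (extendSorts s ρ) → Prop}, DefPred A Q →
      DefPred A (fun v => ∀ a : M s, Q (extendTuple a v)) := by
    rintro Q ⟨φ, hφ⟩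
    let us : ∀ i, Term L (extendSorts s (Sum.elim (paramSort A) ρ))
        (Sum.elim (paramSort A) (extendSorts s ρ) i) := fun i =>
      match i with
      | Sum.inl c => .var (σ := extendSorts s (Sum.elim (paramSort A) ρ)) (some (Sum.inl c))
      | Sum.inr none => .var (σ := extendSorts s (Sum.elim (paramSort A) ρ)) none
      | Sum.inr (some i) => .var (σ := extendSorts s (Sum.elim (paramSort A) ρ)) (some (Sum.inr i))
    refine ⟨Formula.all s (Formula.subst φ us), fun v => ?_⟩
    refine forall_congr' fun a => (hφ _).trans ?_
    unfold FormulaOver.Holds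
    rw [Formula.realize_subst]
    refine iff_of_eq (congrArg _ ?_)
    funext i
    rcases i with c | _ | i <;> rfl
  exact (hall hP.not).not.congr fun v => by simp

theorem DefPred.exists {k : ℕ} {τ : Fin k → L.Sorts} {P : Tuple M ρ → Tuple M τ → Prop}
    (hP : DefPred A (fun v : Tuple M (Sum.elim ρ τ) => P v.fst v.snd)) :
    DefPred A (fun v => ∃ y, P v y) := by
  induction k generalizing α with
  | zero =>
    have h : IsTermMap L (fun v : Tuple M ρ => v.append (fun i => i.elim0 : Tuple M τ)) :=
      IsTermMap.id.append fun i => i.elim0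
    refine (hP.comp h).congr fun v => ⟨fun h => ⟨_, h⟩, fun ⟨y, hy⟩ => ?_⟩
    have : y = fun i => i.elim0 := funext fun i => i.elim0
    rwa [this] at hy
  | succ k ih =>
    let τ' : Fin k → L.Sorts := fun i => τ i.succ
    let Q : Tuple M (extendSorts (τ 0) ρ) → Tuple M τ' → Prop := fun v y =>
      P (fun i => v (some i)) (Fin.cons (α := fun i => M (τ i)) (v none) y)
    have hQ : DefPred A (fun v : Tuple M (Sum.elim (extendSorts (τ 0) ρ) τ') =>
        Q v.fst v.snd) := by
      have h : IsTermMap L (fun v : Tuple M (Sum.elim (extendSorts (τ 0) ρ) τ') =>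
          Tuple.append (fun i => v.fst (some i) : Tuple M ρ)
            (Fin.cons (α := fun i => M (τ i)) (v.fst none) v.snd : Tuple M τ)) := by
        refine IsTermMap.append (fun i => ?_) (fun i => ?_)
        · exact ⟨.var (σ := Sum.elim (extendSorts (τ 0) ρ) τ') (Sum.inl (some i)), fun _ => rfl⟩
        · refine Fin.cases ?_ (fun i => ?_) i
          · exact ⟨.var (σ := Sum.elim (extendSorts (τ 0) ρ) τ') (Sum.inl none), fun _ => rfl⟩
          · exact ⟨.var (σ := Sum.elim (extendSorts (τ 0) ρ) τ') (Sum.inr i), fun _ => rfl⟩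
      exact hP.comp h
    refine (DefPred.exists_one (ih hQ)).congr fun v => ?_
    constructor
    · rintro ⟨a, y, h⟩
      exact ⟨_, h⟩
    · rintro ⟨y, h⟩
      refine ⟨y 0, fun i => y i.succ, ?_⟩
      have : (Fin.cons (α := fun i => M (τ i)) (y 0) (fun i => y i.succ) : Tuple M τ) = y :=
        Fin.cons_self_tail y
      change P v (Fin.cons (α := fun i => M (τ i)) (y 0) (fun i => y i.succ))
      rwa [this]

/-- Parameters may be substituted for variables. -/
theorem DefPred.fibre {P : Tuple M (Sum.elim ρ κ) → Prop} (hP : DefPred A P)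
    {A' : ∀ s, Set (M s)} (hA : ∀ s, A s ⊆ A' s) (b : Tuple M ρ) (hb : ∀ i, b i ∈ A' (ρ i)) :
    DefPred A' (fun y => P (b.append y)) := by
  obtain ⟨φ, hφ⟩ := hP
  let us : ∀ i, Term L (Sum.elim (paramSort A') κ)
      (Sum.elim (paramSort A) (Sum.elim ρ κ) i) := fun i =>
    match i with
    | Sum.inl c => .var (σ := Sum.elim (paramSort A') κ) (Sum.inl ⟨c.1, c.2.1, hA _ c.2.2⟩)
    | Sum.inr (Sum.inl i) => .var (σ := Sum.elim (paramSort A') κ) (Sum.inl ⟨ρ i, b i, hb i⟩)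
    | Sum.inr (Sum.inr i) => .var (σ := Sum.elim (paramSort A') κ) (Sum.inr i)
  refine ⟨Formula.subst φ us, fun v => (hφ _).trans ?_⟩
  unfold FormulaOver.Holds
  rw [Formula.realize_subst]
  refine iff_of_eq (congrArg _ ?_)
  funext i
  rcases i with c | i | i <;> rfl

end Definable

end SortedLanguage

/-! ### Compactness and homogeneity in a saturated structure. -/

namespace SortedLanguage

theorem exists_lower_bound {T : Type*} {𝓕 : Set (T → Prop)} (hne : 𝓕.Nonempty)
    (hdir : ∀ P ∈ 𝓕, ∀ Q ∈ 𝓕, ∃ R ∈ 𝓕, ∀ v, R v → P v ∧ Q v)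
    {Δ : Set (T → Prop)} (hΔ : Δ ⊆ 𝓕) (hfin : Δ.Finite) :
    ∃ R ∈ 𝓕, ∀ v, R v → ∀ P ∈ Δ, P v := by
  induction Δ, hfin using Set.Finite.induction_on with
  | empty =>
    obtain ⟨R, hR⟩ := hne
    exact ⟨R, hR, by simp⟩
  | insert _ _ ih =>
    obtain ⟨R, hR, h⟩ := ih fun P hP => hΔ (Set.mem_insert_of_mem _ hP)
    obtain ⟨R', hR', h'⟩ := hdir R hR _ (hΔ (Set.mem_insert _ _))
    refine ⟨R', hR', fun v hv P hP => ?_⟩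
    rcases hP with rfl | hP
    · exact (h' v hv).2
    · exact h v (h' v hv).1 P hP

section Small

variable {L : SortedLanguage.{u, v, w}} {M : L.Sorts → Type m} {A : ∀ s, Set (M s)}

theorem IsSmall.adjoin [Infinite (Σ s, M s)] (hA : IsSmall A) {α : Type} [Finite α]
    {ρ : α → L.Sorts} (b : Tuple M ρ) :
    IsSmall (fun s => A s ∪ {a | ∃ i, (⟨s, a⟩ : Σ s, M s) = ⟨ρ i, b i⟩}) := by
  unfold IsSmall at *
  let e : (Σ s, A s) ⊕ ULift.{max u m} α →
      Σ s, (A s ∪ {a | ∃ i, (⟨s, a⟩ : Σ s, M s) = ⟨ρ i, b i⟩} : Set (M s)) := fun c =>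
    match c with
    | Sum.inl c => ⟨c.1, c.2.1, Or.inl c.2.2⟩
    | Sum.inr i => ⟨ρ i.down, b i.down, Or.inr ⟨i.down, rfl⟩⟩
  have he : Function.Surjective e := by
    rintro ⟨s, a, ha | ⟨i, hi⟩⟩
    · exact ⟨Sum.inl ⟨s, a, ha⟩, rfl⟩
    · cases hi
      exact ⟨Sum.inr ⟨i⟩, rfl⟩
  refine (Cardinal.mk_le_of_surjective he).trans_lt ?_
  rw [← Cardinal.add_def]
  exact Cardinal.add_lt_of_lt (Cardinal.aleph0_le_mk _) hA
    ((Cardinal.lt_aleph0_of_finite _).trans_le (Cardinal.aleph0_le_mk _))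

end Small

section Saturation

variable {L : SortedLanguage.{u, v, w}} {M : L.Sorts → Type m} [L.Structure M]
  {A : ∀ s, Set (M s)}

/-- Compactness in a saturated structure, for a downward directed family of fibres of
`A`-definable sets. -/
theorem IsSaturated.exists_forall (hM : IsSaturated L M) (hA : IsSmall A) {α : Type} [Finite α]
    {ρ : α → L.Sorts} (b : Tuple M ρ) {k : ℕ} {κ : Fin k → L.Sorts}
    {𝓕 : Set (Tuple M (Sum.elim ρ κ) → Prop)} (hdef : ∀ P ∈ 𝓕, DefPred A P) (hne : 𝓕.Nonempty)
    (hdir : ∀ P ∈ 𝓕, ∀ Q ∈ 𝓕, ∃ R ∈ 𝓕, ∀ v, R v → P v ∧ Q v)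
    (hsat : ∀ P ∈ 𝓕, ∃ y, P (b.append y)) : ∃ y : Tuple M κ, ∀ P ∈ 𝓕, P (b.append y) := by
  rcases finite_or_infinite (Σ s, M s) with hfin | hinf
  -- In a finite structure adjoining b may destroy smallness. Instead, each y would be refuted by
  -- some member of the family, and a common lower bound of these finitely many members is
  -- unsatisfiable.
  · have : Finite (Tuple M κ) := by
      refine Finite.of_injective (fun y : Tuple M κ => fun i => (⟨κ i, y i⟩ : Σ s, M s)) ?_
      intro y y' h
      funext i
      exact eq_of_heq (Sigma.mk.inj (congrFun h i)).2
    by_contra! hcon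
    choose P hP hn using hcon
    obtain ⟨R, hR, h⟩ := exists_lower_bound hne hdir (Δ := Set.range P)
      (by rintro _ ⟨y, rfl⟩; exact hP y) (Set.finite_range P)
    obtain ⟨y, hy⟩ := hsat R hR
    exact hn y (h _ hy _ ⟨y, rfl⟩)
  · let Γ : Set (FormulaOver (fun s => A s ∪ {a | ∃ i, (⟨s, a⟩ : Σ s, M s) = ⟨ρ i, b i⟩}) κ) :=
      {φ | ∃ P ∈ 𝓕, ∀ y, φ.Holds y ↔ P (b.append y)}
    obtain ⟨y, hy⟩ := hM _ (hA.adjoin b) k κ Γ <| by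
      intro Δ hΔ hfin
      have hΔ' : ∀ φ ∈ Δ, ∃ P ∈ 𝓕, ∀ y, φ.Holds y ↔ P (b.append y) := fun φ hφ => hΔ hφ
      choose! P hP hiff using hΔ'
      obtain ⟨R, hR, h⟩ := exists_lower_bound hne hdir (Δ := P '' Δ)
        (by rintro _ ⟨φ, hφ, rfl⟩; exact hP φ hφ) (hfin.image P)
      obtain ⟨y, hy⟩ := hsat R hR
      exact ⟨y, fun φ hφ => (hiff φ hφ y).2 (h _ hy _ ⟨φ, hφ, rfl⟩)⟩
    refine ⟨y, fun P hP => ?_⟩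
    obtain ⟨φ, hφ⟩ := (hdef P hP).fibre
      (A' := fun s => A s ∪ {a | ∃ i, (⟨s, a⟩ : Σ s, M s) = ⟨ρ i, b i⟩})
      (fun s => Set.subset_union_left) b
      (fun i => Or.inr ⟨i, rfl⟩)
    exact (hφ y).2 (hy φ ⟨P, hP, fun y => (hφ y).symm⟩)

variable (A) in
/-- Two tuples have the same type over `A`. -/
def SameType {α : Type} {ρ : α → L.Sorts} (v v' : Tuple M ρ) : Prop :=
  ∀ P : Tuple M ρ → Prop, DefPred A P → (P v ↔ P v')

variable {α β : Type} {ρ : α → L.Sorts} {κ : β → L.Sorts}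

theorem SameType.symm {v v' : Tuple M ρ} (h : SameType A v v') : SameType A v' v :=
  fun P hP => (h P hP).symm

theorem SameType.map {v v' : Tuple M ρ} (h : SameType A v v') {g : Tuple M ρ → Tuple M κ}
    (hg : IsTermMap L g) : SameType A (g v) (g v') :=
  fun _ hP => h _ (hP.comp hg)

theorem SameType.of_imp {v v' : Tuple M ρ} (h : ∀ P, DefPred A P → P v → P v') :
    SameType A v v' := by
  refine fun P hP => ⟨h P hP, fun hv' => ?_⟩
  by_contra hn
  exact h _ hP.not hn hv'

/-- The type of z over v, transported to v', stays satisfiable formula by formula because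
existential quantification preserves definability. -/
theorem SameType.extend (hM : IsSaturated L M) (hA : IsSmall A) [Finite α] {v v' : Tuple M ρ}
    (h : SameType A v v') {k : ℕ} {τ : Fin k → L.Sorts} (z : Tuple M τ) :
    ∃ z', SameType A (v.append z) (v'.append z') := by
  obtain ⟨z', hz'⟩ := hM.exists_forall hA v' (κ := τ)
    (𝓕 := {P | DefPred A P ∧ P (v.append z)}) (fun P hP => hP.1)
    ⟨fun _ => False → False, DefPred.falsum.not, fun h => h⟩
    (fun P hP Q hQ => ⟨fun v => P v ∧ Q v, ⟨hP.1.and hQ.1, hP.2, hQ.2⟩, fun _ h => h⟩)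
    (fun P hP => by
      have : DefPred A (fun v : Tuple M ρ => ∃ y : Tuple M τ, P (v.append y)) :=
        DefPred.exists (hP.1.congr fun v => by rw [Tuple.append_fst_snd])
      exact (h _ this).1 ⟨z, hP.2⟩)
  exact ⟨z', SameType.of_imp fun P hP hv => hz' P ⟨hP, hv⟩⟩

variable {n : ℕ} {σ : Fin n → L.Sorts} {p : TypeOver A σ}

theorem TypeOver.sameType {x x' : Tuple M σ} (hx : x ∈ p.locus) (hx' : x' ∈ p.locus) :
    SameType A x x' := by
  refine SameType.of_imp ?_
  rintro P ⟨φ, hφ⟩ hP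
  rcases p.complete φ with h | h
  · exact (hφ x').2 (hx' φ h)
  · exact absurd ((hφ x).1 hP) (hx _ h)

theorem TypeOver.mem_locus_of_forall {x : Tuple M σ}
    (h : ∀ P, DefPred A P → (∀ y ∈ p.locus, P y) → P x) : x ∈ p.locus :=
  fun φ hφ => h _ ⟨φ, fun _ => Iff.rfl⟩ fun _ hy => hy φ hφ

theorem TypeOver.mem_locus_of_sameType {x x' : Tuple M σ} (hx : x ∈ p.locus)
    (h : SameType A x x') : x' ∈ p.locus :=
  mem_locus_of_forall fun P hP hall => (h P hP).1 (hall x hx)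

theorem relDefinable_iff {k : ℕ} {τ : Fin k → L.Sorts} {X : Set (Tuple M σ)} {Y : Set (Tuple M τ)}
    {R : X → Y → Prop} : RelDefinable A R ↔ ∃ P : Tuple M (Sum.elim σ τ) → Prop, DefPred A P ∧
      ∀ x y, R x y ↔ P (x.1.append y.1) := Iff.rfl

/-- The set `Y` is the trace of a fibre of an `A`-definable set. -/
def IsFibreTrace (p : TypeOver A σ) (Y : Set p.locus) : Prop :=
  ∃ (α : Type) (_ : Finite α) (ρ : α → L.Sorts) (b : Tuple M ρ)
    (P : Tuple M (Sum.elim ρ σ) → Prop), DefPred A P ∧ ∀ y : p.locus, y ∈ Y ↔ P (b.append y.1)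

/-- An invariant relation with a relatively definable fibre is relatively `A`-definable. -/
theorem relDefinable_of_fibre (hM : IsSaturated L M) (hA : IsSmall A)
    {R : p.locus → p.locus → Prop}
    (hinv : ∀ x x' y y' : p.locus, SameType A (x.1.append y.1) (x'.1.append y'.1) →
      (R x y ↔ R x' y')) (x₀ : p.locus) (hfib : IsFibreTrace p {y | R x₀ y}) :
    RelDefinable A R := by
  obtain ⟨α, _, ρ, b, P, hP, hRP⟩ := hfib
  simp only [Set.mem_ofPred_eq] at hRP
  let Good : (Tuple M (Sum.elim σ σ) → Prop) → Prop := fun T =>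
    DefPred A T ∧ ∀ y : p.locus, T (x₀.1.append y.1) → R x₀ y
  let All : (Tuple M σ → Prop) → Prop := fun Q => DefPred A Q ∧ ∀ y ∈ p.locus, Q y
  have hAllTrue : All (fun _ => False → False) := ⟨DefPred.falsum.not, fun _ _ h => h⟩
  have hAllAnd : ∀ {Q Q'}, All Q → All Q' → All (fun v => Q v ∧ Q' v) :=
    fun h h' => ⟨h.1.and h'.1, fun y hy => ⟨h.2 y hy, h'.2 y hy⟩⟩
  let c : Tuple M (Sum.elim ρ σ) := b.append x₀.1
  have hm1 : IsTermMap L (fun v : Tuple M (Sum.elim (Sum.elim ρ σ) σ) =>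
      Tuple.append v.fst.snd v.snd) := IsTermMap.id.fst.snd.append IsTermMap.id.snd
  have hm2 : IsTermMap L (fun v : Tuple M (Sum.elim (Sum.elim ρ σ) σ) =>
      Tuple.append v.fst.fst v.snd) := IsTermMap.id.fst.fst.append IsTermMap.id.snd
  have hm3 : IsTermMap L (fun v : Tuple M (Sum.elim (Sum.elim ρ σ) σ) => v.snd) :=
    IsTermMap.id.snd
  -- If no formula of the type of (x₀, y) implied R on p(𝕄), compactness would give y' in p(𝕄) of
  -- the same type over A and x₀ but outside the fibre, against invariance.
  have step1 : ∀ y, R x₀ y → ∃ T, Good T ∧ T (x₀.1.append y.1) := by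
    intro y hy
    by_contra! hcon
    obtain ⟨y', hy'⟩ := hM.exists_forall hA c (κ := σ)
      (𝓕 := {S | ∃ T Q, (DefPred A T ∧ T (x₀.1.append y.1)) ∧ All Q ∧
        S = fun v => T (v.fst.snd.append v.snd) ∧ Q v.snd ∧ ¬ P (v.fst.fst.append v.snd)})
      (by
        rintro _ ⟨T, Q, hT, hQ, rfl⟩
        exact (hT.1.comp hm1).and ((hQ.1.comp hm3).and (hP.comp hm2).not))
      ⟨_, fun _ => False → False, _, ⟨DefPred.falsum.not, fun h => h⟩, hAllTrue, rfl⟩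
      (by
        rintro _ ⟨T, Q, hT, hQ, rfl⟩ _ ⟨T', Q', hT', hQ', rfl⟩
        exact ⟨_, ⟨fun v => T v ∧ T' v, _, ⟨hT.1.and hT'.1, hT.2, hT'.2⟩, hAllAnd hQ hQ', rfl⟩,
          fun v h => ⟨⟨h.1.1, h.2.1.1, h.2.2⟩, h.1.2, h.2.1.2, h.2.2⟩⟩)
      (by
        rintro _ ⟨T, Q, hT, hQ, rfl⟩
        by_contra! hno
        refine hcon T ⟨hT.1, fun z hz => ?_⟩ hT.2
        by_contra hRz
        exact hRz ((hRP z).2 (hno z.1 hz (hQ.2 z.1 z.2))))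
    have hmem : y' ∈ p.locus := TypeOver.mem_locus_of_forall fun Q hQ hall =>
      (hy' _ ⟨fun _ => False → False, Q, ⟨DefPred.falsum.not, fun h => h⟩, ⟨hQ, hall⟩, rfl⟩).2.1
    have hsame : SameType A (x₀.1.append y.1) (x₀.1.append y') := SameType.of_imp fun T hT h =>
      (hy' _ ⟨T, _, ⟨hT, h⟩, hAllTrue, rfl⟩).1
    have hnP := (hy' _ ⟨fun _ => False → False, _, ⟨DefPred.falsum.not, fun h => h⟩, hAllTrue,
      rfl⟩).2.2
    exact hnP ((hRP ⟨y', hmem⟩).1 ((hinv x₀ x₀ y ⟨y', hmem⟩ hsame).1 hy))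
  -- Good formulas are closed under disjunction, so by compactness a single one covers the fibre.
  have step2 : ∃ T, Good T ∧ ∀ y, R x₀ y → T (x₀.1.append y.1) := by
    by_contra! hcon
    obtain ⟨y', hy'⟩ := hM.exists_forall hA c (κ := σ)
      (𝓕 := {S | ∃ T Q, Good T ∧ All Q ∧
        S = fun v => ¬ T (v.fst.snd.append v.snd) ∧ Q v.snd ∧ P (v.fst.fst.append v.snd)})
      (by
        rintro _ ⟨T, Q, hT, hQ, rfl⟩
        exact (hT.1.comp hm1).not.and ((hQ.1.comp hm3).and (hP.comp hm2)))
      ⟨_, fun _ => False, _, ⟨DefPred.falsum, fun _ h => h.elim⟩, hAllTrue, rfl⟩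
      (by
        rintro _ ⟨T, Q, hT, hQ, rfl⟩ _ ⟨T', Q', hT', hQ', rfl⟩
        exact ⟨_, ⟨fun v => T v ∨ T' v, _, ⟨hT.1.or hT'.1, fun y h => h.elim (hT.2 y) (hT'.2 y)⟩,
          hAllAnd hQ hQ', rfl⟩, fun v h => ⟨⟨fun h' => h.1 (Or.inl h'), h.2.1.1, h.2.2⟩,
            fun h' => h.1 (Or.inr h'), h.2.1.2, h.2.2⟩⟩)
      (by
        rintro _ ⟨T, Q, hT, hQ, rfl⟩
        obtain ⟨y, hy, hn⟩ := hcon T hT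
        exact ⟨y.1, hn, hQ.2 _ y.2, (hRP y).1 hy⟩)
    have hmem : y' ∈ p.locus := TypeOver.mem_locus_of_forall fun Q hQ hall =>
      (hy' _ ⟨fun _ => False, Q, ⟨DefPred.falsum, fun _ h => h.elim⟩, ⟨hQ, hall⟩, rfl⟩).2.1
    have hPy := (hy' _ ⟨fun _ => False, _, ⟨DefPred.falsum, fun _ h => h.elim⟩, hAllTrue, rfl⟩).2.2
    obtain ⟨T, hT, hTy⟩ := step1 ⟨y', hmem⟩ ((hRP ⟨y', hmem⟩).2 hPy)
    exact (hy' _ ⟨T, _, hT, hAllTrue, rfl⟩).1 hTy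
  obtain ⟨T, hT, hRT⟩ := step2
  refine relDefinable_iff.2 ⟨T, hT.1, fun x y => ?_⟩
  obtain ⟨y₀, hy₀⟩ := (TypeOver.sameType x.2 x₀.2).extend hM hA y.1
  have hmem : y₀ ∈ p.locus := TypeOver.mem_locus_of_sameType y.2 (hy₀.map IsTermMap.id.snd)
  rw [hinv x x₀ y ⟨y₀, hmem⟩ hy₀, hy₀ T hT.1]
  exact ⟨hRT _, hT.2 ⟨y₀, hmem⟩⟩

/-- The realizations of a type, as a homogeneous linear order. -/
def homogeneousOrder (hM : IsSaturated L M) (hA : IsSmall A) [LinearOrder p.locus]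
    (hp : IsWeaklyOMinimalPair p (· < ·)) : HomogeneousOrder p.locus where
  -- Entries are read off by term maps from two tuples of the same type, so sublists and repetitions
  -- need no bookkeeping.
  PartialMap l := ∃ (α : Type) (_ : Finite α) (ρ : α → L.Sorts) (v v' : Tuple M ρ),
    SameType A v v' ∧ ∀ q ∈ l, ∃ h : Tuple M ρ → Tuple M σ, IsTermMap L h ∧ h v = q.1.1 ∧
      h v' = q.2.1
  mono := by
    rintro l l' ⟨α, hα, ρ, v, v', h, hl⟩ hsub
    exact ⟨α, hα, ρ, v, v', h, fun q hq => hl q (hsub hq)⟩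
  extend := by
    rintro l ⟨α, hα, ρ, v, v', h, hl⟩ z
    obtain ⟨z', hz'⟩ := h.extend hM hA z.1
    have hmem : z' ∈ p.locus := TypeOver.mem_locus_of_sameType z.2 (hz'.map IsTermMap.id.snd)
    refine ⟨⟨z', hmem⟩, α ⊕ Fin n, inferInstance, Sum.elim ρ σ, _, _, hz', fun q hq => ?_⟩
    rcases List.mem_cons.1 hq with rfl | hq
    · exact ⟨fun v => v.snd, IsTermMap.id.snd, rfl, rfl⟩
    · obtain ⟨g, hg, h1, h2⟩ := hl q hq
      exact ⟨fun v => g v.fst, hg.comp IsTermMap.id.fst, h1, h2⟩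
  swap := by
    rintro l ⟨α, hα, ρ, v, v', h, hl⟩
    refine ⟨α, hα, ρ, v', v, h.symm, fun q hq => ?_⟩
    obtain ⟨q', hq', rfl⟩ := List.mem_map.1 hq
    obtain ⟨g, hg, h1, h2⟩ := hl q' hq'
    exact ⟨g, hg, h2, h1⟩
  single x y := ⟨Fin n, inferInstance, σ, x.1, y.1, TypeOver.sameType x.2 y.2, fun q hq => by
    rw [List.mem_singleton.1 hq]
    exact ⟨fun v => v, IsTermMap.id, rfl, rfl⟩⟩
  paramDef := {Y | IsFibreTrace p Y}
  paramDef_compl := by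
    rintro Y ⟨α, hα, ρ, b, P, hP, h⟩
    exact ⟨α, hα, ρ, b, _, hP.not, fun y => not_congr (h y)⟩
  paramDef_inter := by
    rintro Y Y' ⟨α, hα, ρ, b, P, hP, h⟩ ⟨α', hα', ρ', b', P', hP', h'⟩
    refine ⟨α ⊕ α', inferInstance, Sum.elim ρ ρ', b.append b',
      fun v => P (v.fst.fst.append v.snd) ∧ P' (v.fst.snd.append v.snd),
      (hP.comp (IsTermMap.id.fst.fst.append IsTermMap.id.snd)).and
        (hP'.comp (IsTermMap.id.fst.snd.append IsTermMap.id.snd)), fun y => and_congr (h y) (h' y)⟩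
  joins := by
    rintro Y ⟨α, hα, ρ, b, P, hP, h⟩
    refine JoinsSequences.of_finite_components ?_
    have := hp.finite_components {y | P (b.append y)}
      (hP.fibre (fun s => Set.subset_univ _) b (fun i => Set.mem_univ _))
    have hY : Y = {x : p.locus | x.1 ∈ {y | P (b.append y)}} := Set.ext h
    rwa [hY]
  Def R := RelDefinable A R
  def_inv := by
    rintro R ⟨Z, hZ, hR⟩ x x' y y' ⟨α, hα, ρ, v, v', h, hl⟩
    obtain ⟨g, hg, h1, h2⟩ := hl (x, x') (by simp)
    obtain ⟨g', hg', h1', h2'⟩ := hl (y, y') (by simp)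
    have := (h.map (hg.append hg')) (fun v => v ∈ Z) hZ
    rw [h1, h2, h1', h2'] at this
    rw [hR, hR, this]
  def_fibre := by
    rintro R ⟨Z, hZ, hR⟩ x
    exact ⟨Fin n, inferInstance, σ, x.1, fun v => v ∈ Z, hZ, fun y => hR x y⟩
  def_flip := by
    rintro R ⟨Z, hZ, hR⟩
    exact ⟨_, DefPred.comp (P := fun v => v ∈ Z) hZ (IsTermMap.id.snd.append IsTermMap.id.fst),
      fun x y => hR y x⟩
  def_of := by
    intro R hinv hfib
    rcases isEmpty_or_nonempty p.locus with hemp | ⟨⟨x₀⟩⟩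
    · exact ⟨_, DefPred.falsum, fun x => hemp.elim x⟩
    · refine relDefinable_of_fibre hM hA (fun x x' y y' h => hinv ?_) x₀ (hfib x₀)
      refine ⟨_, inferInstance, _, _, _, h, fun q hq => ?_⟩
      simp only [List.mem_cons, List.not_mem_nil, or_false] at hq
      rcases hq with rfl | rfl
      · exact ⟨fun v => v.fst, IsTermMap.id.fst, rfl, rfl⟩
      · exact ⟨fun v => v.snd, IsTermMap.id.snd, rfl, rfl⟩
  def_lt := hp.definable

end Saturation

end SortedLanguage

/-! ### Convex hulls of equivalence relations -/

section Hull

variable {Z T : Type*} [LinearOrder T] (S : Z → T → Prop) (e : Z → Z → Prop)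

/-- Two points are equal or lie between the values (with respect to `S`) of `e`-related points. -/
def hullRel (u v : T) : Prop :=
  u = v ∨ ∃ a b u₀ v₀, S a u₀ ∧ S b v₀ ∧ e a b ∧ u₀ ≤ u ∧ u₀ ≤ v ∧ u ≤ v₀ ∧ v ≤ v₀

variable {S e}

theorem hullRel_convex : HasConvexClasses (· < ·) (hullRel S e) := by
  have key : ∀ x y z t, hullRel S e x y → hullRel S e x z → y < t → t < z → hullRel S e x t := by
    intro x y z t hy hz h1 h2
    rcases le_total x t with h | h
    · rcases hz with rfl | ⟨a, b, u, v, ha, hb, hab, h3, h4, h5, h6⟩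
      · exact Or.inl (le_antisymm h h2.le)
      · exact Or.inr ⟨a, b, u, v, ha, hb, hab, h3, h3.trans h, h5, h2.le.trans h6⟩
    · rcases hy with rfl | ⟨a, b, u, v, ha, hb, hab, h3, h4, h5, h6⟩
      · exact Or.inl (le_antisymm h1.le h)
      · exact Or.inr ⟨a, b, u, v, ha, hb, hab, h3, h4.trans h1.le, h5, h.trans h5⟩
  exact fun x y hy z hz t h1 h2 => key x y z t hy hz h1 h2

/-- When two hulls overlap, the larger of their lower endpoints lies in both, so `hconv` puts them
in one e-class; the extreme endpoints then span the union. -/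
theorem hullRel_equivalence (he : Equivalence e)
    (hconv : ∀ {a b c u v w}, S a u → S b v → S c w → u ≤ v → v ≤ w → e a c → e a b) :
    Equivalence (hullRel S e) := by
  refine ⟨fun x => Or.inl rfl, ?_, ?_⟩
  · rintro x y (rfl | ⟨a, b, u, v, ha, hb, hab, h3, h4, h5, h6⟩)
    · exact Or.inl rfl
    · exact Or.inr ⟨a, b, u, v, ha, hb, hab, h4, h3, h6, h5⟩
  · rintro x y z (rfl | ⟨a, b, u, v, ha, hb, hab, h3, h4, h5, h6⟩) h
    · exact h
    rcases h with rfl | ⟨c, d, u', v', hc, hd, hcd, h3', h4', h5', h6'⟩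
    · exact Or.inr ⟨a, b, u, v, ha, hb, hab, h3, h4, h5, h6⟩
    have hac : e a c := by
      rcases le_total u u' with h | h
      · exact hconv ha hc hb h (h3'.trans h6) hab
      · exact he.symm (hconv hc ha hd h (h4.trans h5') hcd)
    have had := he.trans hac hcd
    have hcb := he.trans (he.symm hac) hab
    rcases le_total u u' with h | h <;> rcases le_total v v' with h' | h'
    · exact Or.inr ⟨a, d, u, v', ha, hd, had, h3, h.trans h4', h5.trans h', h6'⟩
    · exact Or.inr ⟨a, b, u, v, ha, hb, hab, h3, h.trans h4', h5, h6'.trans h'⟩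
    · exact Or.inr ⟨c, d, u', v', hc, hd, hcd, h.trans h3, h4', h5.trans h', h6'⟩
    · exact Or.inr ⟨c, b, u', v, hc, hb, hcb, h.trans h3, h4', h5, h6'.trans h'⟩

theorem hullRel_iff (he : Equivalence e)
    (hconv : ∀ {a b c u v w}, S a u → S b v → S c w → u ≤ v → v ≤ w → e a c → e a b)
    {a b : Z} {u v : T} (ha : S a u) (hb : S b v) : hullRel S e u v ↔ e a b := by
  constructor
  · rintro (rfl | ⟨c, d, u', v', hc, hd, hcd, h1, h2, h3, h4⟩)
    · exact hconv ha hb ha le_rfl le_rfl (he.refl a)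
    · exact he.trans (he.symm (hconv hc ha hd h1 h3 hcd)) (hconv hc hb hd h2 h4 hcd)
  · intro h
    rcases le_total u v with h' | h'
    · exact Or.inr ⟨a, b, u, v, ha, hb, h, le_rfl, h', h', le_rfl⟩
    · exact Or.inr ⟨b, a, v, u, hb, ha, he.symm h, h', le_rfl, le_rfl, h'⟩

end Hull

/-- A list of convex equivalence relations can be made increasing by taking intersections, keeping
the pullbacks along a map under which they are increasing. -/
theorem exists_increasing_lift {X T : Type*} {r : T → T → Prop} {f : X → T}
    (C : (T → T → Prop) → Prop) (hC : ∀ {F G}, C F → C G → C (fun u v => F u v ∧ G u v))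
    (Es : List (X → X → Prop)) (hchain : Es.Pairwise (· ≤ ·))
    (hE : ∀ E ∈ Es, ∃ F, C F ∧ Equivalence F ∧ HasConvexClasses r F ∧
      ∀ x y, F (f x) (f y) ↔ E x y) :
    ∃ Fs : List (T → T → Prop), Fs.Pairwise (· ≤ ·) ∧
      (∀ F ∈ Fs, C F ∧ Equivalence F ∧ HasConvexClasses r F) ∧
      List.Forall₂ (fun E F => ∀ x y, F (f x) (f y) ↔ E x y) Es Fs := by
  induction Es with
  | nil => exact ⟨[], by simp, by simp, by simp⟩
  | cons E Es ih =>
    rw [List.pairwise_cons] at hchain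
    obtain ⟨Fs, h1, h2, h3⟩ := ih hchain.2 fun E' hE' => hE E' (by simp [hE'])
    obtain ⟨F, hF, he, hc, hFE⟩ := hE E (by simp)
    cases Es with
    | nil =>
      cases h3
      exact ⟨[F], by simp, by simpa using ⟨hF, he, hc⟩, by simpa using hFE⟩
    | cons E' Es =>
      obtain ⟨F', Fs, hF', hFs, rfl⟩ := List.forall₂_cons_left_iff.1 h3
      obtain ⟨g1, g2, g3⟩ := h2 F' (by simp)
      -- By induction `F'` is contained in all later members; since E ≤ E', intersecting with it
      -- leaves the pullback unchanged.
      refine ⟨(fun u v => F u v ∧ F' u v) :: F' :: Fs, ?_, ?_, ?_⟩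
      · rw [List.pairwise_cons]
        refine ⟨fun G hG => ?_, h1⟩
        have hle : F' ≤ G := by
          rcases List.mem_cons.1 hG with rfl | hG
          · exact le_rfl
          · exact (List.pairwise_cons.1 h1).1 G hG
        exact fun u v huv => hle u v huv.2
      · intro G hG
        rcases List.mem_cons.1 hG with rfl | hG
        · refine ⟨hC hF g1, ⟨fun x => ⟨he.refl x, g2.refl x⟩, fun h => ⟨he.symm h.1, g2.symm h.2⟩,
            fun h h' => ⟨he.trans h.1 h'.1, g2.trans h.2 h'.2⟩⟩, ?_⟩
          exact fun x a ha b hb c h h' => ⟨hc x a ha.1 b hb.1 c h h', g3 x a ha.2 b hb.2 c h h'⟩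
        · exact h2 G hG
      · refine List.Forall₂.cons (fun x y => ?_) h3
        rw [hFE, hF']
        exact ⟨fun h => h.1, fun h => ⟨h, hchain.1 E' (by simp) x y h⟩⟩

theorem relCount_eq_of_forall₂ {X T : Type*} {f : X → T} {Es : List (X → X → Prop)}
    {Fs : List (T → T → Prop)}
    (h : List.Forall₂ (fun E F => ∀ x y, F (f x) (f y) ↔ E x y) Es Fs) (x y : X) :
    relCount Fs (f x) (f y) = relCount Es x y := by
  classical
  induction h with
  | nil => rfl
  | cons h _ ih => rw [relCount_cons, relCount_cons, ih]; simp only [h]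

/-! ### Definable convex relations on the target, and the theorem. -/

namespace SortedLanguage

variable {L : SortedLanguage.{u, v, w}} {M : L.Sorts → Type m} [L.Structure M]
  {A : ∀ s, Set (M s)}

/-- Compactness for tuples indexed by any finite type. -/
theorem IsSaturated.exists_forall_finite (hM : IsSaturated L M) (hA : IsSmall A) {β : Type}
    [Finite β] {κ : β → L.Sorts}
    {𝓕 : Set (Tuple M κ → Prop)} (hdef : ∀ P ∈ 𝓕, DefPred A P) (hne : 𝓕.Nonempty)
    (hdir : ∀ P ∈ 𝓕, ∀ Q ∈ 𝓕, ∃ R ∈ 𝓕, ∀ v, R v → P v ∧ Q v)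
    (hsat : ∀ P ∈ 𝓕, ∃ y, P y) : ∃ y : Tuple M κ, ∀ P ∈ 𝓕, P y := by
  obtain ⟨k, ⟨e⟩⟩ := Finite.exists_equiv_fin β
  let g : Tuple M (fun i => κ (e.symm i)) ≃ Tuple M κ :=
    Equiv.piCongrLeft (fun i => M (κ i)) e.symm
  have hg : IsTermMap L g := by
    intro i
    obtain ⟨j, rfl⟩ := e.symm.surjective i
    exact ⟨.var (σ := fun i => κ (e.symm i)) j,
      fun v => Equiv.piCongrLeft_apply_apply (fun i => M (κ i)) e.symm v j⟩
  obtain ⟨y, hy⟩ := hM.exists_forall hA (ρ := fun i : Empty => i.elim) (fun i => i.elim)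
    (κ := fun i => κ (e.symm i))
    (𝓕 := (fun P v => P (g v.snd)) '' 𝓕)
    (by
      rintro _ ⟨P, hP, rfl⟩
      exact (hdef P hP).comp (hg.comp IsTermMap.id.snd))
    (hne.image _)
    (by
      rintro _ ⟨P, hP, rfl⟩ _ ⟨Q, hQ, rfl⟩
      obtain ⟨R, hR, h⟩ := hdir P hP Q hQ
      exact ⟨_, ⟨R, hR, rfl⟩, fun v => h _⟩)
    (by
      rintro _ ⟨P, hP, rfl⟩
      obtain ⟨y, hy⟩ := hsat P hP
      exact ⟨g.symm y, by simpa using hy⟩)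
  exact ⟨g y, fun P hP => hy _ ⟨P, hP, rfl⟩⟩

variable {n : ℕ} {σ : Fin n → L.Sorts} {p : TypeOver A σ}

/-- An `A`-definable ternary property of the realizations of a type holds on an `A`-definable
set containing them. -/
theorem exists_definable_superset (hM : IsSaturated L M) (hA : IsSmall A)
    {C : Tuple M (Sum.elim (Sum.elim σ σ) σ) → Prop} (hC : DefPred A C)
    (h : ∀ x y z : p.locus, C ((x.1.append y.1).append z.1)) :
    ∃ B : Tuple M σ → Prop, DefPred A B ∧ (∀ x : p.locus, B x.1) ∧
      ∀ a b c, B a → B b → B c → C ((a.append b).append c) := by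
  by_contra! hcon
  have h1 : IsTermMap L (fun v : Tuple M (Sum.elim (Sum.elim σ σ) σ) => v.fst.fst) :=
    IsTermMap.id.fst.fst
  have h2 : IsTermMap L (fun v : Tuple M (Sum.elim (Sum.elim σ σ) σ) => v.fst.snd) :=
    IsTermMap.id.fst.snd
  have h3 : IsTermMap L (fun v : Tuple M (Sum.elim (Sum.elim σ σ) σ) => v.snd) :=
    IsTermMap.id.snd
  obtain ⟨y, hy⟩ := hM.exists_forall_finite hA
    (𝓕 := {S | ∃ B : Tuple M σ → Prop, (DefPred A B ∧ ∀ x ∈ p.locus, B x) ∧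
      S = fun v => B v.fst.fst ∧ B v.fst.snd ∧ B v.snd ∧ ¬ C v})
    (by
      rintro _ ⟨B, hB, rfl⟩
      exact (hB.1.comp h1).and ((hB.1.comp h2).and ((hB.1.comp h3).and hC.not)))
    ⟨_, fun _ => False → False, ⟨DefPred.falsum.not, fun _ _ h => h⟩, rfl⟩
    (by
      rintro _ ⟨B, hB, rfl⟩ _ ⟨B', hB', rfl⟩
      exact ⟨_, ⟨fun v => B v ∧ B' v, ⟨hB.1.and hB'.1, fun x hx => ⟨hB.2 x hx, hB'.2 x hx⟩⟩, rfl⟩,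
        fun v h => ⟨⟨h.1.1, h.2.1.1, h.2.2.1.1, h.2.2.2⟩, h.1.2, h.2.1.2, h.2.2.1.2, h.2.2.2⟩⟩)
    (by
      rintro _ ⟨B, hB, rfl⟩
      obtain ⟨a, b, c, ha, hb, hc, hn⟩ := hcon B hB.1 fun x => hB.2 x.1 x.2
      exact ⟨(a.append b).append c, ha, hb, hc, hn⟩)
  have m1 : y.fst.fst ∈ p.locus := TypeOver.mem_locus_of_forall fun B hB hall =>
    (hy _ ⟨B, ⟨hB, hall⟩, rfl⟩).1
  have m2 : y.fst.snd ∈ p.locus := TypeOver.mem_locus_of_forall fun B hB hall =>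
    (hy _ ⟨B, ⟨hB, hall⟩, rfl⟩).2.1
  have m3 : y.snd ∈ p.locus := TypeOver.mem_locus_of_forall fun B hB hall =>
    (hy _ ⟨B, ⟨hB, hall⟩, rfl⟩).2.2.1
  refine (hy _ ⟨fun _ => False → False, ⟨DefPred.falsum.not, fun _ _ h => h⟩, rfl⟩).2.2.2 ?_
  have := h ⟨_, m1⟩ ⟨_, m2⟩ ⟨_, m3⟩
  rwa [Tuple.append_fst_snd, Tuple.append_fst_snd] at this

section Target

variable {k : ℕ} {τ : Fin k → L.Sorts} {D : Set (Tuple M τ)} {f : p.locus → D}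

theorem relDefinable_and {X : Set (Tuple M σ)} {R R' : X → X → Prop} (h : RelDefinable A R)
    (h' : RelDefinable A R') : RelDefinable A (fun x y => R x y ∧ R' x y) := by
  obtain ⟨P, hP, hR⟩ := relDefinable_iff.1 h
  obtain ⟨P', hP', hR'⟩ := relDefinable_iff.1 h'
  exact relDefinable_iff.2 ⟨_, hP.and hP', fun x y => and_congr (hR x y) (hR' x y)⟩

/-- The order pulled back along a relatively definable function is relatively definable. -/
theorem relDefinable_pullback (hD : DefinableOver L A D) {lt : D → D → Prop}
    (hlt : RelDefinable A lt) (hf : RelDefinable A (fun x y => f x = y)) :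
    RelDefinable A (fun x y => lt (f x) (f y)) := by
  obtain ⟨P, hP, hPf⟩ := relDefinable_iff.1 hf
  obtain ⟨Q, hQ, hQlt⟩ := relDefinable_iff.1 hlt
  have hD' : DefPred A (fun v => v ∈ D) := hD
  refine relDefinable_iff.2 ⟨fun w => ∃ u, ∃ v, (u ∈ D ∧ P (w.fst.append u)) ∧
    (v ∈ D ∧ P (w.snd.append v)) ∧ Q (u.append v), ?_, fun x y => ?_⟩
  · refine DefPred.exists (DefPred.exists ?_)
    have i := IsTermMap.id (L := L) (M := M) (ρ := Sum.elim (Sum.elim (Sum.elim σ σ) τ) τ)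
    exact ((hD'.comp i.fst.snd).and (hP.comp (i.fst.fst.fst.append i.fst.snd))).and
      (((hD'.comp i.snd).and (hP.comp (i.fst.fst.snd.append i.snd))).and
        (hQ.comp (i.fst.snd.append i.snd)))
  · constructor
    · intro h
      exact ⟨(f x).1, (f y).1, ⟨(f x).2, (hPf x (f x)).1 rfl⟩, ⟨(f y).2, (hPf y (f y)).1 rfl⟩,
        (hQlt _ _).1 h⟩
    · rintro ⟨u, v, ⟨hu, hu'⟩, ⟨hv, hv'⟩, h⟩
      have e1 : f x = ⟨u, hu⟩ := (hPf x ⟨u, hu⟩).2 hu'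
      have e2 : f y = ⟨v, hv⟩ := (hPf y ⟨v, hv⟩).2 hv'
      rw [e1, e2]
      exact (hQlt ⟨u, hu⟩ ⟨v, hv⟩).2 h

/-- A relatively definable equivalence relation with convex image under `f` is the pullback of a
definable convex equivalence relation. -/
theorem exists_convex_lift (hM : IsSaturated L M) (hA : IsSmall A) (hD : DefinableOver L A D)
    [LinearOrder D] (hlt : RelDefinable A (fun u v : D => u < v))
    (hf : RelDefinable A (fun x y => f x = y)) {E : p.locus → p.locus → Prop}
    (hE : RelDefinable A E) (he : Equivalence E)
    (hconv : ∀ x y z, f x ≤ f y → f y ≤ f z → E x z → E x y) :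
    ∃ F : D → D → Prop, RelDefinable A F ∧ Equivalence F ∧ HasConvexClasses (· < ·) F ∧
      ∀ x y, F (f x) (f y) ↔ E x y := by
  obtain ⟨P, hP, hPf⟩ := relDefinable_iff.1 hf
  obtain ⟨Q, hQ, hQlt⟩ := relDefinable_iff.1 hlt
  obtain ⟨R, hR, hRE⟩ := relDefinable_iff.1 hE
  have hD' : DefPred A (fun v => v ∈ D) := hD
  have hle : ∀ u v : D, u ≤ v ↔ ¬ Q (v.1.append u.1) := fun u v => by rw [← hQlt, not_lt]
  let i₃ := IsTermMap.id (L := L) (M := M) (ρ := Sum.elim (Sum.elim σ σ) σ)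
  -- Off p(𝕄) the formula R need not define an equivalence relation. `C` collects the equivalence
  -- axioms and convexity along the graph P, so that compactness extends them to an A-definable B
  -- containing p(𝕄).
  let C : Tuple M (Sum.elim (Sum.elim σ σ) σ) → Prop := fun t =>
    (R (t.snd.append t.snd) ∧ (R (t.fst.fst.append t.fst.snd) → R (t.fst.snd.append t.fst.fst)) ∧
      (R (t.fst.fst.append t.fst.snd) → R (t.fst.snd.append t.snd) →
        R (t.fst.fst.append t.snd))) ∧
    ((∃ u, ∃ v, ∃ w, (u ∈ D ∧ P (t.fst.fst.append u)) ∧ (v ∈ D ∧ P (t.fst.snd.append v)) ∧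
      (w ∈ D ∧ P (t.snd.append w)) ∧ ¬ Q (v.append u) ∧ ¬ Q (w.append v)) →
        R (t.fst.fst.append t.snd) → R (t.fst.fst.append t.fst.snd))
  have hC : DefPred A C := by
    refine ((hR.comp (i₃.snd.append i₃.snd)).and
      (((hR.comp (i₃.fst.fst.append i₃.fst.snd)).imp (hR.comp (i₃.fst.snd.append i₃.fst.fst))).and
        ((hR.comp (i₃.fst.fst.append i₃.fst.snd)).imp
          ((hR.comp (i₃.fst.snd.append i₃.snd)).imp (hR.comp (i₃.fst.fst.append i₃.snd)))))).and
      ((DefPred.exists (DefPred.exists (DefPred.exists ?_))).imp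
        ((hR.comp (i₃.fst.fst.append i₃.snd)).imp (hR.comp (i₃.fst.fst.append i₃.fst.snd))))
    have i := IsTermMap.id (L := L) (M := M)
      (ρ := Sum.elim (Sum.elim (Sum.elim (Sum.elim (Sum.elim σ σ) σ) τ) τ) τ)
    exact ((hD'.comp i.fst.fst.snd).and
        (hP.comp (i.fst.fst.fst.fst.fst.append i.fst.fst.snd))).and
      (((hD'.comp i.fst.snd).and (hP.comp (i.fst.fst.fst.fst.snd.append i.fst.snd))).and
      (((hD'.comp i.snd).and (hP.comp (i.fst.fst.fst.snd.append i.snd))).and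
      ((hQ.comp (i.fst.snd.append i.fst.fst.snd)).not.and (hQ.comp (i.snd.append i.fst.snd)).not)))
  obtain ⟨B, hB, hBp, hBC⟩ := exists_definable_superset (p := p) hM hA hC <| by
    intro x y z
    refine ⟨⟨(hRE z z).1 (he.refl z), fun h => (hRE y x).1 (he.symm ((hRE x y).2 h)),
      fun h h' => (hRE x z).1 (he.trans ((hRE x y).2 h) ((hRE y z).2 h'))⟩, ?_⟩
    rintro ⟨u, v, w, ⟨hu, hu'⟩, ⟨hv, hv'⟩, ⟨hw, hw'⟩, h1, h2⟩ h
    have e1 : f x = ⟨u, hu⟩ := (hPf x ⟨u, hu⟩).2 hu'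
    have e2 : f y = ⟨v, hv⟩ := (hPf y ⟨v, hv⟩).2 hv'
    have e3 : f z = ⟨w, hw⟩ := (hPf z ⟨w, hw⟩).2 hw'
    refine (hRE x y).1 (hconv x y z ?_ ?_ ((hRE x z).2 h))
    · rw [e1, e2]; exact (hle ⟨u, hu⟩ ⟨v, hv⟩).2 h1
    · rw [e2, e3]; exact (hle ⟨v, hv⟩ ⟨w, hw⟩).2 h2
  let S : {a : Tuple M σ // B a} → D → Prop := fun a u => P (a.1.append u.1)
  let e : {a : Tuple M σ // B a} → {a : Tuple M σ // B a} → Prop := fun a b =>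
    R (a.1.append b.1)
  have hee : Equivalence e :=
    ⟨fun a => (hBC _ _ _ a.2 a.2 a.2).1.1, fun {a b} h => (hBC _ _ _ a.2 b.2 b.2).1.2.1 h,
      fun {a b c} h h' => (hBC _ _ _ a.2 b.2 c.2).1.2.2 h h'⟩
  have hec : ∀ {a b c u v w}, S a u → S b v → S c w → u ≤ v → v ≤ w → e a c → e a b := by
    intro a b c u v w ha hb hc h1 h2 h
    exact (hBC _ _ _ a.2 b.2 c.2).2 ⟨u.1, v.1, w.1, ⟨u.2, ha⟩, ⟨v.2, hb⟩, ⟨w.2, hc⟩,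
      (hle u v).1 h1, (hle v w).1 h2⟩ h
  -- The hulls are taken over B, not over p(𝕄), which makes them A-definable.
  refine ⟨hullRel S e, ?_, hullRel_equivalence hee hec, hullRel_convex, fun x y =>
    (hullRel_iff hee hec (a := ⟨x.1, hBp x⟩) (b := ⟨y.1, hBp y⟩) ((hPf x (f x)).1 rfl)
      ((hPf y (f y)).1 rfl)).trans (hRE x y).symm⟩
  refine relDefinable_iff.2 ⟨fun t => (¬ Q (t.fst.append t.snd) ∧ ¬ Q (t.snd.append t.fst)) ∨
    ∃ a, ∃ b, ∃ u, ∃ v, (B a ∧ u ∈ D ∧ P (a.append u)) ∧ (B b ∧ v ∈ D ∧ P (b.append v)) ∧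
      R (a.append b) ∧ ¬ Q (t.fst.append u) ∧ ¬ Q (t.snd.append u) ∧ ¬ Q (v.append t.fst) ∧
      ¬ Q (v.append t.snd), ?_, fun x y => or_congr ?_ ?_⟩
  · have i₂ := IsTermMap.id (L := L) (M := M) (ρ := Sum.elim τ τ)
    refine ((hQ.comp (i₂.fst.append i₂.snd)).not.and (hQ.comp (i₂.snd.append i₂.fst)).not).or
      (DefPred.exists (DefPred.exists (DefPred.exists (DefPred.exists ?_))))
    have i := IsTermMap.id (L := L) (M := M)
      (ρ := Sum.elim (Sum.elim (Sum.elim (Sum.elim (Sum.elim τ τ) σ) σ) τ) τ)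
    have t1 := i.fst.fst.fst.fst.fst
    have t2 := i.fst.fst.fst.fst.snd
    have a := i.fst.fst.fst.snd
    have b := i.fst.fst.snd
    have u := i.fst.snd
    have v := i.snd
    exact ((hB.comp a).and ((hD'.comp u).and (hP.comp (a.append u)))).and
      (((hB.comp b).and ((hD'.comp v).and (hP.comp (b.append v)))).and
      ((hR.comp (a.append b)).and ((hQ.comp (t1.append u)).not.and
      ((hQ.comp (t2.append u)).not.and
        ((hQ.comp (v.append t1)).not.and (hQ.comp (v.append t2)).not)))))
  · rw [le_antisymm_iff, hle, hle, and_comm]; rfl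
  · constructor
    · rintro ⟨a, b, u, v, ha, hb, hab, h1, h2, h3, h4⟩
      exact ⟨a.1, b.1, u.1, v.1, ⟨a.2, u.2, ha⟩, ⟨b.2, v.2, hb⟩, hab, (hle _ _).1 h1, (hle _ _).1 h2,
        (hle _ _).1 h3, (hle _ _).1 h4⟩
    · rintro ⟨a, b, u, v, ⟨ha, hu, ha'⟩, ⟨hb, hv, hb'⟩, hab, h1, h2, h3, h4⟩
      exact ⟨⟨a, ha⟩, ⟨b, hb⟩, ⟨u, hu⟩, ⟨v, hv⟩, ha', hb', hab, (hle ⟨u, hu⟩ x).2 h1,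
        (hle ⟨u, hu⟩ y).2 h2, (hle x ⟨v, hv⟩).2 h3, (hle y ⟨v, hv⟩).2 h4⟩

end Target

/-- Weak monotonicity, for orders given as instances. -/
theorem weak_monotonicity (hM : IsSaturated L M) (hA : IsSmall A)
    [LinearOrder p.locus] (hp : IsWeaklyOMinimalPair p (· < ·))
    {k : ℕ} {τ : Fin k → L.Sorts} {D : Set (Tuple M τ)} (hD : DefinableOver L A D)
    [LinearOrder D] (hlt : RelDefinable A (fun u v : D => u < v))
    {f : p.locus → D} (hf : RelDefinable A (fun x y => f x = y))
    (hne : ∃ x x', f x ≠ f x') :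
    (∃ Es : List (p.locus → p.locus → Prop),
      (∀ E ∈ Es, HasConvexClasses (· < ·) E) ∧
      (Es.head? = some (kernelRel f) ∧ Es.Pairwise (· < ·) ∧ (∀ E ∈ Es, E ∈ relDefinableEquivs p) ∧
        IsIncreasing (reverseInSeq (· < ·) Es) (· < ·) f) ∧
      ∀ Es' : List (p.locus → p.locus → Prop),
        (Es'.head? = some (kernelRel f) ∧ Es'.Pairwise (· < ·) ∧
          (∀ E ∈ Es', E ∈ relDefinableEquivs p) ∧
          IsIncreasing (reverseInSeq (· < ·) Es') (· < ·) f) → Es' = Es) ∧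
    (∃ Fs : List (D → D → Prop),
      Fs ≠ [] ∧ Fs.Pairwise (· ≤ ·) ∧
      (∀ F ∈ Fs, Equivalence F ∧ RelDefinable A F ∧ HasConvexClasses (· < ·) F) ∧
      IsIncreasing (· < ·) (reverseInSeq (· < ·) Fs) f) := by
  let H := homogeneousOrder hM hA hp
  let q : p.locus → p.locus → Prop := fun x y => f x < f y
  have hq : H.Def q := relDefinable_pullback hD hlt hf
  have hw : HomogeneousOrder.WeakOrder q :=
    ⟨fun h => not_lt_of_gt h, fun h h' => not_lt.2 ((not_lt.1 h').trans (not_lt.1 h))⟩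
  have hinc : HomogeneousOrder.Incomp q = kernelRel f := by
    funext x y
    simp only [HomogeneousOrder.Incomp, kernelRel, q, not_lt, eq_iff_iff]
    exact ⟨fun h => le_antisymm h.2 h.1, fun h => ⟨h.ge, h.le⟩⟩
  have hrep : ∀ Es : List (p.locus → p.locus → Prop),
      HomogeneousOrder.Represents H q (fun _ _ => True) Es ↔
      (Es.head? = some (kernelRel f) ∧ Es.Pairwise (· < ·) ∧ (∀ E ∈ Es, E ∈ relDefinableEquivs p) ∧
        IsIncreasing (reverseInSeq (· < ·) Es) (· < ·) f) := by
    intro Es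
    constructor
    · rintro ⟨h1, h2, h3, h4⟩
      refine ⟨hinc ▸ h1, h2, fun E hE => ⟨(h3 E hE).2, (h3 E hE).1⟩, fun x y hxy => ?_⟩
      by_cases h : f x = f y
      · exact Or.inr h
      · exact Or.inl (h4 x y trivial (by rw [hinc]; exact h) hxy)
    · rintro ⟨h1, h2, h3, h4⟩
      refine ⟨hinc ▸ h1, h2, fun E hE => ⟨(h3 E hE).2, (h3 E hE).1⟩, fun x y _ hn hxy => ?_⟩
      rw [hinc] at hn
      exact (h4 x y hxy).resolve_right hn
  obtain ⟨x₀, x₁, hx⟩ := hne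
  have : Nonempty p.locus := ⟨x₀⟩
  obtain ⟨Es, hEs⟩ := HomogeneousOrder.exists_represents_top hq hw ⟨x₀, x₁, by rwa [hinc]⟩
  refine ⟨⟨Es, fun E hE x a ha b hb c hac hcb => ?_, (hrep Es).1 hEs,
    fun Es' h => ((hrep Es').2 h).unique hw hEs⟩, ?_⟩
  · obtain ⟨hd, he⟩ := hEs.mem_def E hE
    exact he.trans ha (hd.convex he hac.le hcb.le (he.trans (he.symm ha) hb))
  obtain ⟨Fs, h1, h2, h3⟩ := exists_increasing_lift (r := (· < ·)) (f := f)
    (RelDefinable A) (fun h h' => relDefinable_and h h') Es (hEs.chain.imp le_of_lt) fun E hE =>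
      exists_convex_lift hM hA hD hlt hf (hEs.mem_def E hE).1 (hEs.mem_def E hE).2
        fun x y z h h' => hEs.q_convex hw hE (not_lt.2 h) (not_lt.2 h')
  refine ⟨Fs, ?_, h1, fun F hF => ⟨(h2 F hF).2.1, (h2 F hF).1, (h2 F hF).2.2⟩, fun x y hxy => ?_⟩
  · rintro rfl
    have := hEs.head
    cases h3
    simp at this
  by_cases hxy' : f x = f y
  · exact Or.inr hxy'
  refine Or.inl ?_
  -- Both iterated orders reverse with the same parity, so the comparison of f(x) with f(y) can be
  -- read on either side.
  have hiff := hEs.iff hw (x := x) (y := y) (by rw [hinc]; exact hxy')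
  rw [reverseInSeq_iff _ _ (fun E hE _ _ => (hEs.mem_def E hE).2.symm)] at hiff
  rw [reverseInSeq_iff _ _ (fun F hF _ _ => (h2 F hF).2.1.symm), relCount_eq_of_forall₂ h3]
  split_ifs at hiff ⊢ with hev
  · exact hiff.1 hxy
  · exact (lt_or_gt_of_ne hxy').resolve_left fun h => hxy.asymm (hiff.2 h)

end SortedLanguage

open SortedLanguage in
theorem theorem1 {L : SortedLanguage.{u, v, w}} {M : L.Sorts → Type m} [L.Structure M]
    (hM : IsSaturated L M)
    (A : ∀ s, Set (M s)) (hA : IsSmall A)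
    {n : ℕ} {σ : Fin n → L.Sorts} (p : TypeOver A σ) (ltp : p.locus → p.locus → Prop)
    (hp : IsWeaklyOMinimalPair p ltp)
    {k : ℕ} {τ : Fin k → L.Sorts} (D : Set (Tuple M τ)) (hD : DefinableOver L A D)
    (ltD : D → D → Prop) (hltD : IsStrictTotalOrder D ltD) (hltD_def : RelDefinable A ltD)
    (f : p.locus → D) (hf : RelDefinable A (fun x y => f x = y))
    (hf_nonconst : ∃ x x', f x ≠ f x') :
    (∃ Es : List (p.locus → p.locus → Prop),
      (∀ E ∈ Es, HasConvexClasses ltp E) ∧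
      (Es.head? = some (kernelRel f) ∧ Es.Pairwise (· < ·) ∧ (∀ E ∈ Es, E ∈ relDefinableEquivs p) ∧
        IsIncreasing (reverseInSeq ltp Es) ltD f) ∧
      ∀ Es' : List (p.locus → p.locus → Prop),
        (Es'.head? = some (kernelRel f) ∧ Es'.Pairwise (· < ·) ∧
          (∀ E ∈ Es', E ∈ relDefinableEquivs p) ∧
          IsIncreasing (reverseInSeq ltp Es') ltD f) → Es' = Es) ∧
    (∃ Fs : List (D → D → Prop),
      Fs ≠ [] ∧ Fs.Pairwise (· ≤ ·) ∧
      (∀ F ∈ Fs, Equivalence F ∧ RelDefinable A F ∧ HasConvexClasses ltD F) ∧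
      IsIncreasing ltp (reverseInSeq ltD Fs) f) := by
  classical
  have := hp.linear
  let _ : LinearOrder p.locus := linearOrderOfSTO ltp
  let _ : LinearOrder D := linearOrderOfSTO ltD
  exact weak_monotonicity hM hA hp hD hltD_def hf hf_nonconst
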